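/- **Setting.** Let $\mathcal X\subseteq\mathbb R^d$ be the input space, $s$ the number of fidelity levels and $N$ the number of spatial coordinates. For $t=1,\dots,s$ let $\mathbf h_t:\mathcal X\to\mathbb R^{p_t}$ be known basis functions, $r(\cdot,\cdot\mid\boldsymbol\phi_t)$ a correlation function with parameters $\boldsymbol\phi_t$, and $\mathcal X_t\subset\mathcal X$ the finite set of inputs run at level $t$ (not necessarily nested). Put $\mathring{\mathcal X}_t=(\bigcup_{k>t}\mathcal X_k)\setminus\mathcal X_t$ and $\tilde{\mathcal X}_t=\mathcal X_t\cup\mathring{\mathcal X}_t$, so that $\tilde{\mathcal X}_{t}\subset\tilde{\mathcal X}_{t-1}$, and $\tilde n_t=|\tilde{\mathcal X}_t|$. Let $\mathbf x_0\in\mathcal X$ be a new input, not in any $\tilde{\mathcal X}_t$, and assume that for each $t$ the correlation matrix $r(\cdot,\cdot\mid\boldsymbol\phi_t)$ on $\tilde{\mathcal X}_t\cup\{\mathbf x_0\}$ is positive definite. The parallel partial cokriging model is: for each coordinate $j$, $y_{1,j}=\delta_{1,j}$ and $y_{t,j}(\mathbf x)=\gamma_{t-1,j}\,y_{t-1,j}(\mathbf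 x)+\delta_{t,j}(\mathbf x)$ for $t\ge2$, with real constants $\gamma_{t-1,j}$, where, given the parameters, the $\delta_{t,j}$ are independent over $t$ and $j$ and $\delta_{t,j}\sim\mathcal{GP}(\mathbf h_t^\top(\cdot)\boldsymbol\beta_{t,j},\,\sigma^2_{t,j}\,r(\cdot,\cdot\mid\boldsymbol\phi_t))$. At each coordinate the prior is $\prod_{t=1}^s 1/\sigma_{t,j}^2$, flat in all $\boldsymbol\beta_{t,j}$ and $\gamma_{t-1,j}$. Let $\tilde{\mathbf y}_{t,j}=y_{t,j}(\tilde{\mathcal X}_t)$ be the augmented outputs, $\tilde{\mathbf y}^{\mathscr D}_j=(\tilde{\mathbf y}_{t,j})_{t\le s}$ and $\mathbf y_j(\mathbf x_0)=(y_{1,j}(\mathbf x_0),\dots,y_{s,j}(\mathbf x_0))$. Let $\tilde{\mathbf R}_t=r(\tilde{\mathcal X}_t,\tilde{\mathcal X}_t\mid\boldsymbol\phi_t)$, $\mathbf r_t=r(\tilde{\mathcal X}_t,\mathbf x_0\mid\boldsymbol\phi_t)$, $\tilde{\mathbf T}_{1,j}=\mathbf h_1^\top(\tilde{\mathcal X}_1)$,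 $\mathbf T_{1,j}(\mathbf x_0)=\mathbf h_1(\mathbf x_0)$, and for $t\ge2$, $\tilde{\mathbf T}_{t,j}=[\mathbf h_t^\top(\tilde{\mathcal X}_t),\,y_{t-1,j}(\tilde{\mathcal X}_t)]$ and $\mathbf T_{t,j}(\mathbf x_0)=(\mathbf h_t(\mathbf x_0)^\top,\,y_{t-1,j}(\mathbf x_0))^\top$. Let $q_t$ be the number of columns of $\tilde{\mathbf T}_{t,j}$, so $q_1=p_1$ and $q_t=p_t+1$ for $t\ge2$. Put $$\hat{\mathbf b}_{t,j}=(\tilde{\mathbf T}_{t,j}^\top\tilde{\mathbf R}_t^{-1}\tilde{\mathbf T}_{t,j})^{-1}\tilde{\mathbf T}_{t,j}^\top\tilde{\mathbf R}_t^{-1}\tilde{\mathbf y}_{t,j},\qquad S^2_{t,j}=\tilde{\mathbf y}_{t,j}^\top\tilde{\mathbf R}_t^{-1}\{\mathbf I-\tilde{\mathbf T}_{t,j}(\tilde{\mathbf T}_{t,j}^\top\tilde{\mathbf R}_t^{-1}\tilde{\mathbf T}_{t,j})^{-1}\tilde{\mathbf T}_{t,j}^\top\tilde{\mathbf R}_t^{-1}\}\tilde{\mathbf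 y}_{t,j}.$$ **Proposition (Sequential Prediction).** Fix a coordinate $j$. (i) Given the parameters, $(\tilde{\mathbf y}^{\mathscr D}_j,\mathbf y_j(\mathbf x_0))$ has as density $L$ the product over $t$ of the normal densities of $y_{t,j}(\tilde{\mathcal X}_t\cup\{\mathbf x_0\})$ with mean $\mathbf h_t^\top(\cdot)\boldsymbol\beta_{t,j}+\gamma_{t-1,j}\,y_{t-1,j}(\cdot)$ (only $\mathbf h_1^\top(\cdot)\boldsymbol\beta_{1,j}$ for $t=1$) and covariance $\sigma^2_{t,j}\,r(\cdot,\cdot\mid\boldsymbol\phi_t)$ on these inputs. (ii) Let the augmented data be such that, for every $t$, $\tilde{\mathbf T}_{t,j}$ has full column rank and $S^2_{t,j}>0$. Then the predictive distribution $\pi(\mathbf y_j(\mathbf x_0)\mid\tilde{\mathbf y}^{\mathscr D}_j,\boldsymbol\phi)$, whose density is proportional to the integral of $L$ against the prior, is a probability distribution and factorizes as $$\pi(\mathbf y_j(\mathbf x_0)\mid\tilde{\mathbf y}_j^{\mathscr D},\boldsymbol\phi)=\pi(y_{1,j}(\mathbf x_0)\mid\tilde{\mathbf y}_{1,j},\boldsymbol\phi_1)\prod_{t=2}^{s}\pi(y_{t,j}(\mathbf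 x_0)\mid\tilde{\mathbf y}_{t,j},\tilde{\mathbf y}_{t-1,j},y_{t-1,j}(\mathbf x_0),\boldsymbol\phi_t).$$ Here the factor of level $t$ is the conditional predictive distribution of $y_{t,j}(\mathbf x_0)$ given $\tilde{\mathbf y}^{\mathscr D}_j$ and $y_{k,j}(\mathbf x_0)$, $k<t$. It depends only on the quantities displayed and is the Student-$t$ distribution with degrees of freedom, location and (squared) scale parameter $$\nu_{t}=\tilde n_t-q_t,\qquad \mu_{t,j}=\mathbf T_{t,j}(\mathbf x_0)^\top\hat{\mathbf b}_{t,j}+\mathbf r_t^\top\tilde{\mathbf R}_t^{-1}(\tilde{\mathbf y}_{t,j}-\tilde{\mathbf T}_{t,j}\hat{\mathbf b}_{t,j}),\qquad V_{t,j}=\frac{S^2_{t,j}}{\tilde n_t-q_t}\,c_{t,j},$$ $$c_{t,j}=r(\mathbf x_0,\mathbf x_0\mid\boldsymbol\phi_t)-\mathbf r_t^\top\tilde{\mathbf R}_t^{-1}\mathbf r_t+[\mathbf T_{t,j}(\mathbf x_0)-\tilde{\mathbf T}_{t,j}^\top\tilde{\mathbf R}_t^{-1}\mathbf r_t]^\top(\tilde{\mathbf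 T}_{t,j}^\top\tilde{\mathbf R}_t^{-1}\tilde{\mathbf T}_{t,j})^{-1}[\mathbf T_{t,j}(\mathbf x_0)-\tilde{\mathbf T}_{t,j}^\top\tilde{\mathbf R}_t^{-1}\mathbf r_t],$$ where $\nu_t>0$ and $V_{t,j}>0$. -/

import Mathlib

open MeasureTheory ProbabilityTheory Matrix
open scoped ENNReal

noncomputable section

namespace PPCokriging

/-! ### Two families of densities -/

/-- Density of the multivariate normal distribution `N(m, C)` on `ℝ^ι`. -/
def normalPDF {ι : Type*} [Fintype ι] [DecidableEq ι]
    (m : ι → ℝ) (C : Matrix ι ι ℝ) (y : ι → ℝ) : ℝ :=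
  (Real.sqrt ((2 * Real.pi) ^ Fintype.card ι * C.det))⁻¹ *
    Real.exp (-((y - m) ⬝ᵥ (C⁻¹ *ᵥ (y - m))) / 2)

/-- Density of the Student-t distribution with `ν` degrees of freedom, location `m` and
(squared) scale parameter `V`. -/
def studentPDF (ν m V x : ℝ) : ℝ :=
  Real.Gamma ((ν + 1) / 2) / (Real.Gamma (ν / 2) * Real.sqrt (ν * Real.pi * V)) *
    (1 + (x - m) ^ 2 / (ν * V)) ^ (-((ν + 1) / 2))

/-- The Student-t distribution with `ν` degrees of freedom, location `m` and (squared) scale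
parameter `V`, as a measure on `ℝ`. -/
def studentT (ν m V : ℝ) : Measure ℝ :=
  volume.withDensity fun x => ENNReal.ofReal (studentPDF ν m V x)

/-! ### Fidelity levels, inputs and designs -/

/-- The level immediately below `t`: this type is empty for the first level and has exactly one
element for every other level. -/
abbrev Pred {s : ℕ} (t : Fin s) : Type := {u : Fin s // u.val + 1 = t.val}

/-- The known ingredients of the model, on the input space `𝒳 ⊆ ℝ^d` with `s` levels. Nothing is
assumed about them here. -/
structure Setup (d s : ℕ) (𝒳 : Set (EuclideanSpace ℝ (Fin d))) where
  /-- number of basis functions at each level -/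
  p : Fin s → ℕ
  /-- basis functions of the mean at each level, common to all spatial coordinates -/
  h : (t : Fin s) → 𝒳 → Fin (p t) → ℝ
  /-- the correlation function `r(x, x' | φ)`, with the parameter as first argument -/
  r : (Fin d → ℝ) → 𝒳 → 𝒳 → ℝ
  /-- the correlation parameters at each level, common to all spatial coordinates -/
  φ : Fin s → Fin d → ℝ
  /-- the inputs at which the simulator of each level was run (not necessarily nested) -/
  X : Fin s → Finset 𝒳
  /-- the new input -/
  x0 : 𝒳

variable {d s : ℕ} {𝒳 : Set (EuclideanSpace ℝ (Fin d))}

open Classical in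
/-- The missing inputs at level `t`: the inputs run at some higher level but not at level `t`. -/
def Setup.missing (S : Setup d s 𝒳) (t : Fin s) : Finset 𝒳 :=
  (Finset.univ.filter fun k : Fin s => t < k).biUnion S.X \ S.X t

open Classical in
/-- The augmented design at level `t`. -/
def Setup.aug (S : Setup d s 𝒳) (t : Fin s) : Finset 𝒳 := S.X t ∪ S.missing t

/-- The augmented designs are nested. -/
theorem Setup.aug_subset (S : Setup d s 𝒳) {u t : Fin s} (hut : u.val + 1 = t.val)
    {x : 𝒳} (hx : x ∈ S.aug t) : x ∈ S.aug u := by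
  classical
  have hlt : u < t := by rw [Fin.lt_def]; omega
  simp only [Setup.aug, Setup.missing, Finset.mem_union, Finset.mem_sdiff, Finset.mem_biUnion,
    Finset.mem_filter, Finset.mem_univ, true_and] at hx ⊢
  by_cases hu : x ∈ S.X u
  · exact Or.inl hu
  · refine Or.inr ⟨?_, hu⟩
    rcases hx with hx | ⟨⟨k, hk, hxk⟩, -⟩
    · exact ⟨t, hlt, hx⟩
    · exact ⟨k, hlt.trans hk, hxk⟩

/-- Indices of the regression coefficients at level `t`: one for each basis function and, above
the first level, one for the scale discrepancy. -/
abbrev Setup.Reg (S : Setup d s 𝒳) (t : Fin s) : Type := Fin (S.p t) ⊕ Pred t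

/-- Augmented output at one spatial coordinate, over all levels and all augmented designs. -/
abbrev Setup.Data (S : Setup d s 𝒳) : Type := (t : Fin s) → S.aug t → ℝ

/-- Parameters at one spatial coordinate: the vectors `b_t = (β_t, γ_{t-1})` (only `β_1` at the
first level) and the variances `σ²_t`. -/
abbrev Setup.Params (S : Setup d s 𝒳) : Type := ((t : Fin s) → S.Reg t → ℝ) × (Fin s → ℝ)

/-! ### The model -/

/-- `Z` is, under `P`, a Gaussian process with mean function `m` and covariance function `c`. -/
structure IsGP {Ω T : Type*} [MeasurableSpace Ω] (Z : T → Ω → ℝ) (P : Measure Ω)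
    (m : T → ℝ) (c : T → T → ℝ) : Prop where
  isGaussianProcess : IsGaussianProcess Z P
  mean : ∀ x, ∫ ω, Z x ω ∂P = m x
  cov : ∀ x x', covariance (Z x) (Z x') P = c x x'

/-- The discrepancy `δ_t(x) = y_t(x) - γ_{t-1} y_{t-1}(x)` of a family `y` of output functions at
one coordinate; at the first level it is `y_1(x)` itself. -/
def Setup.discrepancy (S : Setup d s 𝒳) {Ω : Type*} (y : Fin s → 𝒳 → Ω → ℝ)
    (θ : S.Params) (t : Fin s) (x : 𝒳) (ω : Ω) : ℝ :=
  y t x ω - ∑ u : Pred t, θ.1 t (Sum.inr u) * y u.1 x ω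

/-- The parallel partial cokriging model with `N` spatial coordinates: under the distribution
`P θ` belonging to the parameters `θ` with positive variances, the outputs satisfy
`y_{t,j}(x) = γ_{t-1,j} y_{t-1,j}(x) + δ_{t,j}(x)`, where the processes `δ_{1,j} = y_{1,j}` and
`δ_{t,j}` are independent over all levels `t` and coordinates `j`, and `δ_{t,j}` is a Gaussian
process with mean `h_tᵀ β_{t,j}` and covariance function `σ²_{t,j} r(·,· | φ_t)`. -/
structure Setup.IsModel (S : Setup d s 𝒳) {N : ℕ} {Ω : Type*} [MeasurableSpace Ω]
    (y : Fin N → Fin s → 𝒳 → Ω → ℝ) (P : (Fin N → S.Params) → Measure Ω) : Prop where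
  measurable : ∀ j t x, Measurable (y j t x)
  isProbabilityMeasure : ∀ θ : Fin N → S.Params, (∀ j t, 0 < (θ j).2 t) →
    IsProbabilityMeasure (P θ)
  isGP : ∀ θ : Fin N → S.Params, (∀ j t, 0 < (θ j).2 t) → ∀ j t,
    IsGP (S.discrepancy (y j) (θ j) t) (P θ)
      (fun x => ∑ i, S.h t x i * (θ j).1 t (Sum.inl i))
      (fun x x' => (θ j).2 t * S.r (S.φ t) x x')
  indep : ∀ θ : Fin N → S.Params, (∀ j t, 0 < (θ j).2 t) →
    iIndepFun (fun (a : Fin N × Fin s) (ω : Ω) (x : 𝒳) =>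
      S.discrepancy (y a.1) (θ a.1) a.2 x ω) (P θ)

/-- The augmented output and the outputs at the new input, over all levels, of a family `y` of
output functions at one coordinate. -/
def Setup.observe (S : Setup d s 𝒳) {Ω : Type*} (y : Fin s → 𝒳 → Ω → ℝ) (ω : Ω) :
    S.Data × (Fin s → ℝ) :=
  (fun t x => y t x.1 ω, fun t => y t S.x0 ω)

/-- The noninformative prior at one coordinate: flat in all `β_t` and `γ_{t-1}` and
proportional to `1 / σ²_t` in each variance. (The constant does not affect predictive
distributions.) -/
def Setup.prior (S : Setup d s 𝒳) : Measure S.Params :=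
  (volume : Measure ((t : Fin s) → S.Reg t → ℝ)).prod
    (Measure.pi fun _ : Fin s =>
      (volume.restrict (Set.Ioi (0 : ℝ))).withDensity fun v => ENNReal.ofReal (1 / v))

/-! ### Design matrices and correlation matrices -/

/-- The matrix `T̃_t = [H̃_t, W̃_{t-1}]` over the augmented design of level `t`; it is `H̃_1` at
the first level. The column `W̃_{t-1}` holds the level `t-1` outputs at the inputs of level `t`. -/
def Setup.T (S : Setup d s 𝒳) (t : Fin s) (Y : S.Data) : Matrix (S.aug t) (S.Reg t) ℝ :=
  Matrix.of fun x =>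
    Sum.elim (fun i => S.h t x.1 i) (fun u => Y u.1 ⟨x.1, S.aug_subset u.2 x.2⟩)

/-- The row `T_t(x_0) = [h_t(x_0), y_{t-1}(x_0)]`; it is `h_1(x_0)` at the first level. Here `y0`
is the vector of outputs at the new input over all levels. -/
def Setup.T0 (S : Setup d s 𝒳) (t : Fin s) (y0 : Fin s → ℝ) : S.Reg t → ℝ :=
  Sum.elim (fun i => S.h t S.x0 i) (fun u => y0 u.1)

/-- The correlation matrix of level `t` on its augmented design. -/
def Setup.R (S : Setup d s 𝒳) (t : Fin s) : Matrix (S.aug t) (S.aug t) ℝ :=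
  Matrix.of fun x x' => S.r (S.φ t) x.1 x'.1

/-- The correlations of level `t` between its augmented design and the new input. -/
def Setup.r0 (S : Setup d s 𝒳) (t : Fin s) : S.aug t → ℝ :=
  fun x => S.r (S.φ t) x.1 S.x0

/-- The inputs of the augmented design of level `t` together with the new input (`none`). -/
def Setup.pt (S : Setup d s 𝒳) (t : Fin s) : Option (S.aug t) → 𝒳
  | none => S.x0
  | some x => x.1

/-- The correlation matrix of level `t` on its augmented design enlarged by the new input. -/
def Setup.Rfull (S : Setup d s 𝒳) (t : Fin s) :
    Matrix (Option (S.aug t)) (Option (S.aug t)) ℝ :=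
  Matrix.of fun a a' => S.r (S.φ t) (S.pt t a) (S.pt t a')

/-- The design matrix of level `t` on its augmented design enlarged by the new input. -/
def Setup.Tfull (S : Setup d s 𝒳) (t : Fin s) (Y : S.Data) (y0 : Fin s → ℝ) :
    Matrix (Option (S.aug t)) (S.Reg t) ℝ :=
  Matrix.of fun a => a.elim (S.T0 t y0) (fun x => S.T t Y x)

/-- The level `t` outputs on its augmented design enlarged by the new input. -/
def Setup.yfull (S : Setup d s 𝒳) (t : Fin s) (Y : S.Data) (y0 : Fin s → ℝ) :
    Option (S.aug t) → ℝ :=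
  fun a => a.elim (y0 t) (Y t)

/-! ### Sampling density and predictive distributions -/

open Classical in
/-- The sampling density of the augmented output `Y` and the outputs `y0` at the new input, at
one coordinate, given the parameters: the product over the levels of the densities of
`N(T_t b_t, σ²_t R_t)` on the augmented design enlarged by the new input. -/
def Setup.sampling (S : Setup d s 𝒳) (θ : S.Params) (Y : S.Data) (y0 : Fin s → ℝ) : ℝ≥0∞ :=
  ∏ t, ENNReal.ofReal
    (normalPDF (S.Tfull t Y y0 *ᵥ θ.1 t) (θ.2 t • S.Rfull t) (S.yfull t Y y0))

/-- The sampling density integrated against the prior: the marginal density of the augmented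
output and the outputs at the new input given the correlation parameters. -/
def Setup.marginal (S : Setup d s 𝒳) (Y : S.Data) (y0 : Fin s → ℝ) : ℝ≥0∞ :=
  ∫⁻ θ, S.sampling θ Y y0 ∂S.prior

/-- The predictive density at `y0` of the outputs at the new input over all levels, given the
augmented output. -/
def Setup.predictiveDensity (S : Setup d s 𝒳) (Y : S.Data) (y0 : Fin s → ℝ) : ℝ≥0∞ :=
  S.marginal Y y0 / ∫⁻ z, S.marginal Y z

/-- The predictive distribution of the outputs at the new input over all levels, given the
augmented output. -/
def Setup.predictive (S : Setup d s 𝒳) (Y : S.Data) : Measure (Fin s → ℝ) :=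
  volume.withDensity (S.predictiveDensity Y)

/-- The conditional predictive density at `u` of the level `t` output at the new input, given the
augmented output and the outputs `y0 k`, `k < t`, at the new input of the lower levels: in the
predictive density the levels above `t` are integrated out, and the result is normalized in the
level `t` variable. The entries `y0 k` with `k ≥ t` play no role. -/
def Setup.condDensity (S : Setup d s 𝒳) (t : Fin s) (Y : S.Data) (y0 : Fin s → ℝ) (u : ℝ) :
    ℝ≥0∞ :=
  lmarginal (fun _ => volume) (Finset.Ioi t) (S.predictiveDensity Y) (Function.update y0 t u) /
    lmarginal (fun _ => volume) (Finset.Ici t) (S.predictiveDensity Y) y0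

/-- The conditional predictive distribution of the level `t` output at the new input, given the
augmented output and the lower-level outputs at the new input. -/
def Setup.condPredictive (S : Setup d s 𝒳) (t : Fin s) (Y : S.Data) (y0 : Fin s → ℝ) :
    Measure ℝ :=
  volume.withDensity (S.condDensity t Y y0)

/-! ### Degrees of freedom, location and scale -/

/-- Generalized least squares coefficients `(TᵀR⁻¹T)⁻¹TᵀR⁻¹y`. -/
def glsCoef {ι κ : Type*} [Fintype ι] [DecidableEq ι] [Fintype κ] [DecidableEq κ]
    (T : Matrix ι κ ℝ) (R : Matrix ι ι ℝ) (y : ι → ℝ) : κ → ℝ :=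
  ((Tᵀ * R⁻¹ * T)⁻¹ * Tᵀ * R⁻¹) *ᵥ y

/-- The quadratic form `yᵀQy` with `Q = R⁻¹{I - T(TᵀR⁻¹T)⁻¹TᵀR⁻¹}`. -/
def glsS2 {ι κ : Type*} [Fintype ι] [DecidableEq ι] [Fintype κ] [DecidableEq κ]
    (T : Matrix ι κ ℝ) (R : Matrix ι ι ℝ) (y : ι → ℝ) : ℝ :=
  y ⬝ᵥ ((R⁻¹ * (1 - T * (Tᵀ * R⁻¹ * T)⁻¹ * Tᵀ * R⁻¹)) *ᵥ y)

/-- The degrees of freedom `ñ_t - q_t`: the number of inputs in the augmented design minus the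
number of columns of `T̃_t`. -/
def Setup.dof (S : Setup d s 𝒳) (t : Fin s) : ℝ :=
  ((S.aug t).card : ℝ) - (Fintype.card (S.Reg t) : ℝ)

open Classical in
/-- The quadratic form `S²(φ_t, Y_t)`. -/
def Setup.S2 (S : Setup d s 𝒳) (t : Fin s) (Y : S.Data) : ℝ :=
  glsS2 (S.T t Y) (S.R t) (Y t)

open Classical in
/-- The location `T_t(x_0) b̂_t + r_tᵀ(x_0) R̃_t⁻¹ (Y_t - T̃_t b̂_t)`. -/
def Setup.location (S : Setup d s 𝒳) (t : Fin s) (Y : S.Data) (y0 : Fin s → ℝ) : ℝ :=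
  S.T0 t y0 ⬝ᵥ glsCoef (S.T t Y) (S.R t) (Y t) +
    S.r0 t ⬝ᵥ ((S.R t)⁻¹ *ᵥ (Y t - S.T t Y *ᵥ glsCoef (S.T t Y) (S.R t) (Y t)))

open Classical in
/-- The factor `c_t(x_0)` of the scale. -/
def Setup.c (S : Setup d s 𝒳) (t : Fin s) (Y : S.Data) (y0 : Fin s → ℝ) : ℝ :=
  S.r (S.φ t) S.x0 S.x0 - S.r0 t ⬝ᵥ ((S.R t)⁻¹ *ᵥ S.r0 t) +
    (S.T0 t y0 - ((S.T t Y)ᵀ * (S.R t)⁻¹) *ᵥ S.r0 t) ⬝ᵥ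
      (((S.T t Y)ᵀ * (S.R t)⁻¹ * S.T t Y)⁻¹ *ᵥ
        (S.T0 t y0 - ((S.T t Y)ᵀ * (S.R t)⁻¹) *ᵥ S.r0 t))

/-- The (squared) scale parameter `S²(φ_t, Y_t) / (ñ_t - q_t) * c_t(x_0)`. -/
def Setup.scale (S : Setup d s 𝒳) (t : Fin s) (Y : S.Data) (y0 : Fin s → ℝ) : ℝ :=
  S.S2 t Y / S.dof t * S.c t Y y0

/-- Regular augmented output: at every level the matrix `T̃_t` has full column rank and
`S²(φ_t, Y_t) > 0`, that is, `Y_t` is not an exact combination of the columns of `T̃_t`. -/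
def Setup.Regular (S : Setup d s 𝒳) (Y : S.Data) : Prop :=
  ∀ t, LinearIndependent ℝ (fun c : S.Reg t => fun x => S.T t Y x c) ∧ 0 < S.S2 t Y

end PPCokriging

end

/-! The two assertions have separate proofs.

Sampling density. At one coordinate, the outputs on the augmented designs and at the new input are
mapped to the discrepancies by a linear map `Setup.shear`. The map is square because the augmented
designs are nested: every lower-level output it needs is itself an observed entry. It is block
triangular in the levels with identity diagonal blocks, so its determinant is 1 and it preserves
Lebesgue measure. The discrepancies are independent Gaussian vectors over the levels, each with a
normal density, and pulling the product of these densities back along the shear gives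
`Setup.sampling` (`Setup.map_observe`).

Prediction. For fixed outputs both the prior and the sampling density are products over the levels,
and level t involves only its own coefficients and variance, so the marginal density is a product of
one-level integrals. At one level (`lintegral_level`), block elimination splits off the new point,
the normal equations split off the least squares fit, and completing the square after a rank-one
update of the Gram matrix leaves three pieces: a normal density in the coefficients, a normal
density at the new output with variance v c, and a term in S². The first integrates to 1;
integrating the others against dv / v is an inverse gamma mixture of normals, which is a Student-t
density times a constant. That constant depends only on the augmented data, not on the outputs at
the new input, because the matrix determinant lemma trades the determinant of the updated Gram
matrix for the factor c.

The joint predictive density is therefore proportional to a product of Student-t densities, the t-th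
of which sees only coordinates up to t and integrates to 1 in coordinate t. Integrating from the top
level downwards (`lmarginal_prod_cond`) gives the total mass and all conditional densities. -/

noncomputable section

namespace PPCokriging

/-! ### Product measures and densities -/

section Product

variable {ι : Type*} [Fintype ι] {α : ι → Type*} [∀ i, MeasurableSpace (α i)]

/-- Tonelli's theorem for a finite product of functions of one variable each. -/
theorem lintegral_pi_prod (μ : ∀ i, Measure (α i)) [∀ i, SigmaFinite (μ i)]
    {f : ∀ i, α i → ℝ≥0∞} (hf : ∀ i, Measurable (f i)) :
    ∫⁻ x, ∏ i, f i (x i) ∂Measure.pi μ = ∏ i, ∫⁻ x, f i x ∂μ i := by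
  classical
  have hm : Measurable fun x : ∀ i, α i => ∏ i, f i (x i) :=
    Finset.measurable_prod _ fun i _ => (hf i).comp (measurable_pi_apply i)
  -- The variables are integrated out one at a time; `s` is the set of those already done.
  have key : ∀ s : Finset ι, ∀ x : ∀ i, α i,
      lmarginal μ s (fun x => ∏ i, f i (x i)) x =
        ∏ i, if i ∈ s then ∫⁻ z, f i z ∂μ i else f i (x i) := by
    intro s
    induction s using Finset.induction_on with
    | empty => intro x; simp
    | insert a s ha ih =>
      intro x
      rw [lmarginal_insert _ hm ha]
      simp_rw [ih]
      rw [← Finset.mul_prod_erase _ _ (Finset.mem_univ a)]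
      have h1 : ∀ z : α a, (∏ i, if i ∈ s then ∫⁻ z, f i z ∂μ i
            else f i (Function.update x a z i)) =
          f a z * ∏ i ∈ Finset.univ.erase a,
            if i ∈ insert a s then ∫⁻ z, f i z ∂μ i else f i (x i) := by
        intro z
        rw [← Finset.mul_prod_erase _ _ (Finset.mem_univ a)]
        simp only [ha, if_false, Function.update_self]
        congr 1
        refine Finset.prod_congr rfl fun i hi => ?_
        have hia : i ≠ a := Finset.ne_of_mem_erase hi
        simp [hia]
      simp_rw [h1]
      rw [lintegral_mul_const _ (hf a)]
      simp
  -- A marginal integral needs a base point. If there is none, some factor is an empty type and both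
  -- sides vanish.
  by_cases h : Nonempty (∀ i, α i)
  · obtain ⟨x⟩ := h
    rw [lintegral_eq_lmarginal_univ x, key]
    simp
  · have : ∃ i, IsEmpty (α i) := by
      by_contra hc
      push Not at hc
      exact h ⟨fun i => (hc i).some⟩
    obtain ⟨i, hi⟩ := this
    have hE : IsEmpty (∀ i, α i) := ⟨fun x => hi.elim (x i)⟩
    rw [Finset.prod_eq_zero (Finset.mem_univ i)]
    · simp [Measure.eq_zero_of_isEmpty]
    · simp [Measure.eq_zero_of_isEmpty]

theorem pi_withDensity (μ : ∀ i, Measure (α i)) [∀ i, SigmaFinite (μ i)]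
    {f : ∀ i, α i → ℝ≥0∞} (hf : ∀ i, Measurable (f i))
    [∀ i, SigmaFinite ((μ i).withDensity (f i))] :
    Measure.pi (fun i => (μ i).withDensity (f i)) =
      (Measure.pi μ).withDensity fun x => ∏ i, f i (x i) := by
  refine Measure.pi_eq fun s hs => ?_
  rw [withDensity_apply _ (MeasurableSet.univ_pi hs), Measure.restrict_pi_pi,
    lintegral_pi_prod _ hf]
  exact Finset.prod_congr rfl fun i _ => (withDensity_apply _ (hs i)).symm

end Product

/-- The density is constant on the fibres of `T`, since `f = (f ∘ g) ∘ T`; a one-sided inverse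
suffices. -/
theorem map_withDensity_of_leftInverse {α β : Type*} [MeasurableSpace α] [MeasurableSpace β]
    {μ : Measure α} {T : α → β} {g : β → α} (hT : Measurable T) (hg : Measurable g)
    (h : Function.LeftInverse g T) {f : α → ℝ≥0∞} (hf : Measurable f) :
    (μ.withDensity f).map T = (μ.map T).withDensity fun y => f (g y) := by
  ext s hs
  rw [Measure.map_apply hT hs, withDensity_apply _ (hT hs), withDensity_apply _ hs,
    setLIntegral_map (f := fun y => f (g y)) hs (hf.comp hg) hT]
  simp [h _]

/-! ### Multivariate normal densities -/

section Normal

variable {ι : Type*} [Fintype ι] [DecidableEq ι]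

theorem measurable_normalPDF (m : ι → ℝ) (C : Matrix ι ι ℝ) : Measurable (normalPDF m C) := by
  have : Continuous (normalPDF m C) := by
    unfold normalPDF
    have h : Continuous fun y : ι → ℝ => C⁻¹ *ᵥ (y - m) :=
      Continuous.matrix_mulVec continuous_const (by fun_prop)
    have h2 : Continuous fun y : ι → ℝ => (y - m) ⬝ᵥ (C⁻¹ *ᵥ (y - m)) :=
      Continuous.dotProduct (by fun_prop) h
    fun_prop
  exact this.measurable

theorem dotProduct_inv_mul_transpose (A : Matrix ι ι ℝ) (z : ι → ℝ) :
    z ⬝ᵥ ((A * Aᵀ)⁻¹ *ᵥ z) = ∑ i, (A⁻¹ *ᵥ z) i ^ 2 := by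
  rw [Matrix.mul_inv_rev, ← Matrix.mulVec_mulVec, Matrix.dotProduct_mulVec,
    ← Matrix.transpose_nonsing_inv, Matrix.vecMul_transpose]
  simp [dotProduct, sq]

theorem prod_gaussianPDF_eq_normalPDF (A : Matrix ι ι ℝ) (m y : ι → ℝ) :
    ENNReal.ofReal |A.det⁻¹| * ∏ i, gaussianPDF ((A⁻¹ *ᵥ m) i) 1 ((A⁻¹ *ᵥ y) i) =
      ENNReal.ofReal (normalPDF m (A * Aᵀ) y) := by
  simp only [gaussianPDF]
  rw [← ENNReal.ofReal_prod_of_nonneg fun i _ => gaussianPDFReal_nonneg _ _ _,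
    ← ENNReal.ofReal_mul (abs_nonneg _)]
  congr 1
  unfold normalPDF
  rw [dotProduct_inv_mul_transpose, Matrix.mulVec_sub]
  simp only [gaussianPDFReal, Finset.prod_mul_distrib, Finset.prod_const, ← Real.exp_sum,
    Finset.card_univ, Pi.sub_apply, NNReal.coe_one, mul_one]
  rw [← mul_assoc]
  congr 1
  · have h1 : √(2 * Real.pi) ^ Fintype.card ι = √((2 * Real.pi) ^ Fintype.card ι) := by
      rw [← Real.sqrt_sq (x := √(2 * Real.pi) ^ Fintype.card ι) (by positivity), ← pow_mul,
        mul_comm (Fintype.card ι) 2, pow_mul, Real.sq_sqrt (by positivity)]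
    rw [Matrix.det_mul, Matrix.det_transpose, ← sq A.det,
      Real.sqrt_mul (x := (2 * Real.pi) ^ Fintype.card ι) (by positivity), Real.sqrt_sq_eq_abs,
      mul_inv, abs_inv, mul_comm, inv_pow, h1]
  · congr 1
    rw [neg_div, Finset.sum_div, ← Finset.sum_neg_distrib]
    exact Finset.sum_congr rfl fun i _ => neg_div _ _

/-- Change of variables: the Jacobian of `A` supplies the root of `det (A Aᵀ)`, and the sum of
squares of `A⁻¹ (y - m)` is the quadratic form of `(A Aᵀ)⁻¹`. -/
theorem map_mulVec_pi_gaussianReal {A : Matrix ι ι ℝ} (hA : A.det ≠ 0) (m : ι → ℝ) :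
    (Measure.pi fun i => gaussianReal ((A⁻¹ *ᵥ m) i) 1).map (fun z => A *ᵥ z) =
      volume.withDensity fun y => ENNReal.ofReal (normalPDF m (A * Aᵀ) y) := by
  have hmeas : ∀ B : Matrix ι ι ℝ, Measurable fun z : ι → ℝ => B *ᵥ z := fun B =>
    (Continuous.matrix_mulVec continuous_const continuous_id).measurable
  have h1 : ∀ i, gaussianReal ((A⁻¹ *ᵥ m) i) 1 =
      volume.withDensity (gaussianPDF ((A⁻¹ *ᵥ m) i) 1) := fun i =>
    gaussianReal_of_var_ne_zero _ one_ne_zero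
  have : ∀ i, SigmaFinite (volume.withDensity (gaussianPDF ((A⁻¹ *ᵥ m) i) 1)) := fun i => by
    rw [← h1]; infer_instance
  simp_rw [h1]
  rw [pi_withDensity _ fun i => measurable_gaussianPDF _ _,
    map_withDensity_of_leftInverse (g := fun z => A⁻¹ *ᵥ z) (hmeas _) (hmeas _)]
  · have h2 := Real.map_matrix_volume_pi_eq_smul_volume_pi hA
    rw [← volume_pi]
    have h3 : (⇑(toLin' A) : (ι → ℝ) → ι → ℝ) = fun z => A *ᵥ z := by
      ext z i; simp [toLin'_apply]
    rw [h3] at h2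
    rw [h2, withDensity_smul_measure, ← withDensity_smul']
    · congr 1
      ext y
      exact prod_gaussianPDF_eq_normalPDF A m y
    · exact ENNReal.ofReal_ne_top
  · intro z
    simp [Matrix.mulVec_mulVec, Matrix.nonsing_inv_mul _ (isUnit_iff_ne_zero.2 hA)]
  · exact Finset.measurable_prod _ fun i _ =>
      (measurable_gaussianPDF _ _).comp (measurable_pi_apply i)

theorem exists_mul_transpose_of_posDef {C : Matrix ι ι ℝ} (hC : C.PosDef) :
    ∃ A : Matrix ι ι ℝ, A.det ≠ 0 ∧ C = A * Aᵀ := by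
  open scoped MatrixOrder in
  obtain ⟨B, hB⟩ := CStarAlgebra.nonneg_iff_eq_star_mul_self.mp hC.posSemidef.nonneg
  have hB' : C = Bᵀ * Bᵀᵀ := by
    rw [hB, Matrix.star_eq_conjTranspose, Matrix.conjTranspose_eq_transpose_of_trivial,
      Matrix.transpose_transpose]
  refine ⟨Bᵀ, fun h => hC.det_pos.ne' ?_, hB'⟩
  rw [hB', Matrix.det_mul, h, zero_mul]

theorem isProbabilityMeasure_normalPDF (m : ι → ℝ) {C : Matrix ι ι ℝ} (hC : C.PosDef) :
    IsProbabilityMeasure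
      (volume.withDensity fun y => ENNReal.ofReal (normalPDF m C y)) := by
  obtain ⟨A, hA, rfl⟩ := exists_mul_transpose_of_posDef hC
  rw [← map_mulVec_pi_gaussianReal hA]
  exact Measure.isProbabilityMeasure_map
    (Continuous.matrix_mulVec continuous_const continuous_id).measurable.aemeasurable

theorem lintegral_normalPDF (m : ι → ℝ) {C : Matrix ι ι ℝ} (hC : C.PosDef) :
    ∫⁻ y, ENNReal.ofReal (normalPDF m C y) = 1 := by
  have := (isProbabilityMeasure_normalPDF m hC).measure_univ
  rwa [withDensity_apply _ MeasurableSet.univ, Measure.restrict_univ] at this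

/-- A Gaussian vector with positive definite covariance matrix has the normal density. -/
theorem map_eq_withDensity_normalPDF {Ω : Type*} [MeasurableSpace Ω] {P : Measure Ω}
    {X : ι → Ω → ℝ} (hX : HasGaussianLaw (fun ω i => X i ω) P) {m : ι → ℝ} {C : Matrix ι ι ℝ}
    (hm : ∀ i, ∫ ω, X i ω ∂P = m i) (hcov : ∀ i i', covariance (X i) (X i') P = C i i')
    (hC : C.PosDef) :
    P.map (fun ω i => X i ω) =
      volume.withDensity fun y => ENNReal.ofReal (normalPDF m C y) := by
  obtain ⟨A, hA, rfl⟩ := exists_mul_transpose_of_posDef hC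
  have hP := hX.isProbabilityMeasure
  have hAu : IsUnit A.det := isUnit_iff_ne_zero.2 hA
  have hL2 : ∀ i, MemLp (X i) 2 P := fun i => (hX.eval i).memLp_two
  -- Whitening: `A⁻¹ X` has identity covariance, and uncorrelated jointly Gaussian coordinates are
  -- independent, so its law is a product.
  set Z : ι → Ω → ℝ := fun i ω => ∑ k, A⁻¹ i k * X k ω with hZ
  have hZX : (fun ω i => Z i ω) = fun ω => A⁻¹ *ᵥ fun i => X i ω := by
    ext ω i; simp [hZ, Matrix.mulVec, dotProduct]
  have hZg : HasGaussianLaw (fun ω i => Z i ω) P := by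
    rw [hZX]
    exact hX.map_fun (LinearMap.toContinuousLinearMap (toLin' A⁻¹))
  have hcovZ : ∀ i i', covariance (Z i) (Z i') P = (1 : Matrix ι ι ℝ) i i' := by
    intro i i'
    have h1 : (1 : Matrix ι ι ℝ) = A⁻¹ * (A * Aᵀ) * A⁻¹ᵀ := by
      rw [← Matrix.mul_assoc, Matrix.nonsing_inv_mul _ hAu, Matrix.one_mul,
        ← Matrix.transpose_mul, Matrix.nonsing_inv_mul _ hAu, Matrix.transpose_one]
    rw [h1, hZ]
    rw [covariance_fun_sum_fun_sum (fun k => (hL2 k).const_mul _) (fun k => (hL2 k).const_mul _)]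
    simp only [covariance_const_mul_left, covariance_const_mul_right, hcov]
    generalize A * Aᵀ = C
    simp only [Matrix.mul_apply, Matrix.transpose_apply, Finset.sum_mul]
    rw [Finset.sum_comm]
    refine Finset.sum_congr rfl fun k _ => Finset.sum_congr rfl fun l _ => by ring
  have hmZ : ∀ i, ∫ ω, Z i ω ∂P = (A⁻¹ *ᵥ m) i := by
    intro i
    rw [hZ]
    simp only
    rw [integral_finsetSum _ fun k _ => ((hX.eval k).integrable).const_mul _]
    simp [integral_const_mul, hm, Matrix.mulVec, dotProduct]
  have hind : iIndepFun Z P := hZg.iIndepFun_of_covariance_eq_zero fun i i' h => by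
    rw [hcovZ, Matrix.one_apply_ne h]
  have hlaw : P.map (fun ω i => Z i ω) =
      Measure.pi fun i => gaussianReal ((A⁻¹ *ᵥ m) i) 1 := by
    rw [(iIndepFun_iff_map_fun_eq_pi_map fun i => (hZg.eval i).aemeasurable).1 hind]
    congr 1
    ext1 i
    rw [(hZg.eval i).map_eq_gaussianReal, hmZ, ← covariance_self (hZg.eval i).aemeasurable, hcovZ]
    simp
  rw [← map_mulVec_pi_gaussianReal hA, ← hlaw, AEMeasurable.map_map_of_aemeasurable _
    hZg.aemeasurable]
  · congr 1
    ext ω i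
    simp only [Function.comp_apply]
    rw [show (fun i => Z i ω) = A⁻¹ *ᵥ fun i => X i ω from congrFun hZX ω, Matrix.mulVec_mulVec,
      Matrix.mul_nonsing_inv _ hAu, Matrix.one_mulVec]
  · exact (Continuous.matrix_mulVec continuous_const continuous_id).measurable.aemeasurable

end Normal

/-! ### Inverse gamma mixtures and the Student-t distribution -/

section Student

/-- The integral of the unnormalized inverse gamma density. -/
theorem lintegral_inverseGamma {a B : ℝ} (ha : 0 < a) (hB : 0 < B) :
    ∫⁻ v in Set.Ioi (0 : ℝ), ENNReal.ofReal (v ^ (-a - 1) * Real.exp (-(B / v))) =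
      ENNReal.ofReal (Real.Gamma a * B ^ (-a)) := by
  have himg : (fun v : ℝ => v⁻¹) '' Set.Ioi 0 = Set.Ioi 0 := by
    ext v
    simp
  -- The substitution `v ↦ v⁻¹` turns the integrand into a multiple of a gamma density.
  have h1 := lintegral_image_eq_lintegral_abs_deriv_mul (s := Set.Ioi (0 : ℝ))
    (f := fun v => v⁻¹) (f' := fun v => -(v ^ 2)⁻¹) measurableSet_Ioi
    (fun x hx => (hasDerivAt_inv (ne_of_gt hx)).hasDerivWithinAt) inv_injective.injOn
    (fun v => ENNReal.ofReal (v ^ (-a - 1) * Real.exp (-(B / v))))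
  rw [himg] at h1
  rw [h1]
  have h2 : ∫⁻ v in Set.Ioi (0 : ℝ), gammaPDF a B v = 1 := by
    rw [← lintegral_gammaPDF_eq_one ha hB,
      ← lintegral_add_compl (μ := volume) (gammaPDF a B) (measurableSet_Ioi (a := (0 : ℝ))),
      Set.compl_Ioi, setLIntegral_congr Iio_ae_eq_Iic.symm, lintegral_gammaPDF_of_nonpos le_rfl,
      add_zero]
  rw [← mul_one (ENNReal.ofReal (Real.Gamma a * B ^ (-a))), ← h2,
    ← lintegral_const_mul' _ _ ENNReal.ofReal_ne_top]
  refine setLIntegral_congr_fun measurableSet_Ioi fun v (hv : 0 < v) => ?_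
  have hG := Real.Gamma_pos_of_pos ha
  rw [gammaPDF_of_nonneg hv.le, ← ENNReal.ofReal_mul (abs_nonneg _),
    ← ENNReal.ofReal_mul (by positivity)]
  congr 1
  have e1 : |(-(v ^ 2)⁻¹)| = v ^ (-2 : ℝ) := by
    rw [abs_neg, abs_of_pos (by positivity), Real.rpow_neg hv.le, Real.rpow_two]
  have e2 : v⁻¹ ^ (-a - 1) = v ^ (a + 1) := by
    rw [Real.inv_rpow hv.le, ← Real.rpow_neg hv.le]; congr 1; ring
  have e3 : v ^ (-2 : ℝ) * v ^ (a + 1) = v ^ (a - 1) := by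
    rw [← Real.rpow_add hv]; congr 1; ring
  have e4 : B ^ (-a) * B ^ a = 1 := by
    rw [← Real.rpow_add hB]; simp
  rw [e1, e2, ← mul_assoc, e3, div_inv_eq_mul]
  field_simp
  linear_combination (-1 : ℝ) * e4

theorem measurable_studentPDF {α : Type*} [MeasurableSpace α] (ν : ℝ) {m V x : α → ℝ}
    (hm : Measurable m) (hV : Measurable V) (hx : Measurable x) :
    Measurable fun z => studentPDF ν (m z) (V z) (x z) := by
  unfold studentPDF
  fun_prop

theorem studentPDF_pos {ν m V : ℝ} (hν : 0 < ν) (hV : 0 < V) (x : ℝ) :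
    0 < studentPDF ν m V x := by
  have h1 := Real.Gamma_pos_of_pos (show 0 < (ν + 1) / 2 by positivity)
  have h2 := Real.Gamma_pos_of_pos (show 0 < ν / 2 by positivity)
  have := Real.pi_pos
  unfold studentPDF
  positivity

/-- The Student-t density is an inverse gamma mixture of normal densities. -/
theorem lintegral_inverseGamma_mul_gaussian {ν S c : ℝ} (hν : 0 < ν) (hS : 0 < S) (hc : 0 < c)
    (m x : ℝ) :
    ∫⁻ v in Set.Ioi (0 : ℝ), ENNReal.ofReal (v ^ (-(ν / 2) - 1) * Real.exp (-(S / 2 / v)) *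
        ((√(2 * Real.pi * (v * c)))⁻¹ * Real.exp (-(x - m) ^ 2 / (2 * (v * c))))) =
      ENNReal.ofReal (Real.Gamma (ν / 2) * (S / 2) ^ (-(ν / 2)) *
        studentPDF ν m (S / ν * c) x) := by
  have hpi := Real.pi_pos
  set q := (x - m) ^ 2 with hq
  have hq0 : 0 ≤ q := sq_nonneg _
  -- Both exponentials combine to `exp (-(B / v))`, and the root of `v` raises the shape from `ν /
  -- 2` to `(ν + 1) / 2`.
  set B := (S + q / c) / 2 with hB
  have hBpos : 0 < B := by positivity
  have hG := Real.Gamma_pos_of_pos (show 0 < ν / 2 by positivity)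
  have h1 : ∀ v ∈ Set.Ioi (0 : ℝ), ENNReal.ofReal (v ^ (-(ν / 2) - 1) *
        Real.exp (-(S / 2 / v)) * ((√(2 * Real.pi * (v * c)))⁻¹ *
          Real.exp (-q / (2 * (v * c))))) =
      ENNReal.ofReal (√(2 * Real.pi * c))⁻¹ *
        ENNReal.ofReal (v ^ (-((ν + 1) / 2) - 1) * Real.exp (-(B / v))) := by
    intro v (hv : 0 < v)
    rw [← ENNReal.ofReal_mul (by positivity)]
    congr 1
    have e1 : √(2 * Real.pi * (v * c)) = √(2 * Real.pi * c) * v ^ (1 / 2 : ℝ) := by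
      rw [← Real.sqrt_eq_rpow, ← Real.sqrt_mul (by positivity)]; congr 1; ring
    have e2 : v ^ (-((ν + 1) / 2) - 1) = v ^ (-(ν / 2) - 1) * (v ^ (1 / 2 : ℝ))⁻¹ := by
      rw [← Real.rpow_neg hv.le, ← Real.rpow_add hv]; congr 1; ring
    have e3 : Real.exp (-(B / v)) = Real.exp (-(S / 2 / v)) * Real.exp (-q / (2 * (v * c))) := by
      rw [← Real.exp_add, hB]; congr 1; field_simp; ring
    rw [e1, e2, e3, mul_inv]
    ring
  rw [setLIntegral_congr_fun measurableSet_Ioi h1, lintegral_const_mul' _ _ ENNReal.ofReal_ne_top,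
    lintegral_inverseGamma (by positivity) hBpos, ← ENNReal.ofReal_mul (by positivity)]
  congr 1
  have hνV : ν * (S / ν * c) = S * c := by field_simp
  unfold studentPDF
  rw [← hq, hνV, show ν * Real.pi * (S / ν * c) = Real.pi * (S * c) by field_simp]
  have f1 : B = S / 2 * (1 + q / (S * c)) := by rw [hB]; field_simp
  have f2 : √(Real.pi * (S * c)) = √(2 * Real.pi * c) * (S / 2) ^ (1 / 2 : ℝ) := by
    rw [← Real.sqrt_eq_rpow, ← Real.sqrt_mul (by positivity)]; congr 1; ring
  have f3 : (S / 2) ^ (-((ν + 1) / 2)) = (S / 2) ^ (-(ν / 2)) * ((S / 2) ^ (1 / 2 : ℝ))⁻¹ := by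
    rw [← Real.rpow_neg (by positivity), ← Real.rpow_add (by positivity)]; congr 1; ring
  rw [f1, Real.mul_rpow (by positivity) (by positivity), f2, f3]
  field_simp

/-- The mixture representation with `S = ν` and `c = V` has scale exactly `V`. By Tonelli the normal
densities integrate to 1 first, leaving the inverse gamma constant `K`, which cancels. -/
theorem lintegral_studentPDF {ν V : ℝ} (hν : 0 < ν) (hV : 0 < V) (m : ℝ) :
    ∫⁻ x, ENNReal.ofReal (studentPDF ν m V x) = 1 := by
  have hpi := Real.pi_pos
  have hG := Real.Gamma_pos_of_pos (show 0 < ν / 2 by positivity)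
  set K := Real.Gamma (ν / 2) * (ν / 2) ^ (-(ν / 2)) with hK
  have hKpos : 0 < K := by positivity
  have h1 : ∀ x, ENNReal.ofReal K * ENNReal.ofReal (studentPDF ν m V x) =
      ∫⁻ v in Set.Ioi (0 : ℝ), ENNReal.ofReal (v ^ (-(ν / 2) - 1) * Real.exp (-(ν / 2 / v)) *
        ((√(2 * Real.pi * (v * V)))⁻¹ * Real.exp (-(x - m) ^ 2 / (2 * (v * V))))) := by
    intro x
    rw [lintegral_inverseGamma_mul_gaussian hν hν hV, div_self hν.ne', one_mul,
      ENNReal.ofReal_mul hKpos.le]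
  have h2 : ∫⁻ x, ENNReal.ofReal K * ENNReal.ofReal (studentPDF ν m V x) = ENNReal.ofReal K := by
    simp_rw [h1]
    rw [lintegral_lintegral_swap]
    · rw [hK, ← lintegral_inverseGamma (by positivity) (by positivity)]
      refine setLIntegral_congr_fun measurableSet_Ioi fun v (hv : 0 < v) => ?_
      have h3 : ∫⁻ x, ENNReal.ofReal (gaussianPDFReal m (v * V).toNNReal x) = 1 :=
        lintegral_gaussianPDFReal_eq_one m (by simpa using by positivity)
      simp only [gaussianPDFReal, Real.coe_toNNReal _ (show 0 ≤ v * V by positivity)] at h3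
      rw [← mul_one (ENNReal.ofReal _), ← h3, ← lintegral_const_mul' _ _ ENNReal.ofReal_ne_top]
      refine lintegral_congr fun x => ?_
      rw [← ENNReal.ofReal_mul (by positivity)]
    · refine Measurable.aemeasurable ?_
      simp only [Function.uncurry_def]
      fun_prop
  rw [lintegral_const_mul' _ _ ENNReal.ofReal_ne_top] at h2
  have hne : ENNReal.ofReal K ≠ 0 := by simpa using hKpos
  exact (ENNReal.mul_eq_left hne ENNReal.ofReal_ne_top).1 h2

end Student

/-! ### Positive definite matrices -/

section PosDef

theorem posDef_submatrix_some {ι : Type*} {Q : Matrix (Option ι) (Option ι) ℝ} (hQ : Q.PosDef) :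
    (Q.submatrix some some).PosDef :=
  hQ.submatrix (Option.some_injective ι)

theorem symm_of_posDef {n : Type*} {C : Matrix n n ℝ} (hC : C.PosDef) (i k : n) :
    C i k = C k i := by
  have := hC.isHermitian.apply i k
  simpa using this.symm

theorem transpose_of_posDef {n : Type*} {C : Matrix n n ℝ} (hC : C.PosDef) : Cᵀ = C := by
  ext i k
  exact symm_of_posDef hC k i

theorem inv_mulVec_dotProduct {n : Type*} [Fintype n] [DecidableEq n] {C : Matrix n n ℝ}
    (hC : C.PosDef) (v w : n → ℝ) : (C⁻¹ *ᵥ v) ⬝ᵥ w = v ⬝ᵥ (C⁻¹ *ᵥ w) := by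
  rw [Matrix.dotProduct_mulVec, ← Matrix.mulVec_transpose, transpose_of_posDef hC.inv]

theorem isUnit_det_of_posDef {n : Type*} [Fintype n] [DecidableEq n] {C : Matrix n n ℝ}
    (hC : C.PosDef) : IsUnit C.det := isUnit_iff_ne_zero.2 hC.det_pos.ne'

theorem posDef_gram {ι κ : Type*} [Fintype ι] [DecidableEq ι] [Fintype κ]
    {R : Matrix ι ι ℝ} {T : Matrix ι κ ℝ} (hR : R.PosDef)
    (hT : LinearIndependent ℝ fun c : κ => fun x => T x c) : (Tᵀ * R⁻¹ * T).PosDef := by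
  have hinj : Function.Injective T.mulVec := Matrix.mulVec_injective_iff.2 hT
  have := hR.inv.conjTranspose_mul_mul_same hinj
  rwa [Matrix.conjTranspose_eq_transpose_of_trivial] at this

theorem posDef_add_rank_one {κ : Type*} [Fintype κ] {A : Matrix κ κ ℝ}
    (hA : A.PosDef) (g : κ → ℝ) {k : ℝ} (hk : 0 < k) : (A + k⁻¹ • vecMulVec g g).PosDef := by
  refine hA.add_posSemidef ?_
  have := Matrix.posSemidef_vecMulVec_self_star (R := ℝ) g
  rw [star_trivial] at this
  exact this.smul (inv_nonneg.2 hk.le)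

end PosDef

/-! ### Matrices bordered by one index: block elimination -/

section Border

variable {ι : Type*} [Fintype ι] [DecidableEq ι]

/-- The Schur complement of the principal block `some` in a matrix with one further index. -/
def schur (Q : Matrix (Option ι) (Option ι) ℝ) : ℝ :=
  Q none none - (fun i => Q (some i) none) ⬝ᵥ
    ((Q.submatrix some some)⁻¹ *ᵥ fun i => Q (some i) none)

variable {Q : Matrix (Option ι) (Option ι) ℝ}

theorem det_eq_mul_schur (hQ : Q.PosDef) :
    Q.det = (Q.submatrix some some).det * schur Q := by
  have hR := posDef_submatrix_some hQ
  let : Invertible (Q.submatrix some some) :=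
    Matrix.invertibleOfIsUnitDet _ (isUnit_det_of_posDef hR)
  have h := Matrix.det_fromBlocks₁₁ (Q.submatrix some some)
    (Matrix.of fun (i : ι) (_ : Unit) => Q (some i) none)
    (Matrix.of fun (_ : Unit) (i : ι) => Q none (some i))
    (Matrix.of fun (_ _ : Unit) => Q none none)
  have h2 : Matrix.fromBlocks (Q.submatrix some some)
      (Matrix.of fun (i : ι) (_ : Unit) => Q (some i) none)
      (Matrix.of fun (_ : Unit) (i : ι) => Q none (some i))
      (Matrix.of fun (_ _ : Unit) => Q none none) =
      Q.submatrix (Equiv.optionEquivSumPUnit ι).symm (Equiv.optionEquivSumPUnit ι).symm := by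
    ext a b
    rcases a with a | a <;> rcases b with b | b <;> rfl
  rw [h2, Matrix.det_submatrix_equiv_self] at h
  rw [h, Matrix.det_unique (n := Unit), Matrix.invOf_eq_nonsing_inv]
  congr 1
  simp only [schur, Matrix.sub_apply, Matrix.mul_assoc, Matrix.mul_apply, Matrix.of_apply,
    dotProduct, Matrix.mulVec]
  congr 1
  exact Finset.sum_congr rfl fun i _ => by rw [symm_of_posDef hQ]

theorem schur_pos (hQ : Q.PosDef) : 0 < schur Q := by
  have h1 := hQ.det_pos
  rw [det_eq_mul_schur hQ] at h1
  exact (pos_iff_pos_of_mul_pos h1).1 (posDef_submatrix_some hQ).det_pos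

/-- The quadratic form of the inverse of a bordered matrix. -/
theorem dotProduct_inv_mulVec_option (hQ : Q.PosDef) (w : Option ι → ℝ) :
    w ⬝ᵥ (Q⁻¹ *ᵥ w) =
      (w ∘ some) ⬝ᵥ ((Q.submatrix some some)⁻¹ *ᵥ (w ∘ some)) +
        (w none - (fun i => Q (some i) none) ⬝ᵥ
          ((Q.submatrix some some)⁻¹ *ᵥ (w ∘ some))) ^ 2 / schur Q := by
  have hR := posDef_submatrix_some hQ
  have hκ := schur_pos hQ
  set R := Q.submatrix some some with hRdef
  set ρ : ι → ℝ := fun i => Q (some i) none with hρ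
  set z := w ∘ some with hz
  set a := (w none - ρ ⬝ᵥ (R⁻¹ *ᵥ z)) / schur Q with ha
  -- The solution of `Q x = w` by block elimination; once it is verified, the quadratic form can be
  -- read off from `w ⬝ᵥ x`.
  set x : Option ι → ℝ := fun o => o.elim a (R⁻¹ *ᵥ z - a • (R⁻¹ *ᵥ ρ)) with hx
  have haκ : a * schur Q = w none - ρ ⬝ᵥ (R⁻¹ *ᵥ z) := by rw [ha]; field_simp
  have hQx : Q *ᵥ x = w := by
    ext o
    rw [Matrix.mulVec, dotProduct, Fintype.sum_option]
    cases o with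
    | none =>
      have h1 : ∑ i, Q none (some i) * x (some i) = ρ ⬝ᵥ (R⁻¹ *ᵥ z - a • (R⁻¹ *ᵥ ρ)) :=
        Finset.sum_congr rfl fun i _ => by rw [symm_of_posDef hQ]; rfl
      rw [h1, dotProduct_sub, dotProduct_smul, smul_eq_mul]
      change Q none none * a + _ = _
      have : schur Q = Q none none - ρ ⬝ᵥ (R⁻¹ *ᵥ ρ) := rfl
      rw [this] at haκ
      linarith
    | some i =>
      have h1 : ∑ k, Q (some i) (some k) * x (some k) =
          (R *ᵥ (R⁻¹ *ᵥ z - a • (R⁻¹ *ᵥ ρ))) i := rfl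
      rw [h1, Matrix.mulVec_sub, Matrix.mulVec_smul, Matrix.mulVec_mulVec, Matrix.mulVec_mulVec,
        Matrix.mul_nonsing_inv _ (isUnit_det_of_posDef hR), Matrix.one_mulVec, Matrix.one_mulVec]
      change ρ i * a + (z i - a * ρ i) = w (some i)
      simp [hz]
      ring
  have hinv : Q⁻¹ *ᵥ w = x := by
    rw [← hQx, Matrix.mulVec_mulVec, Matrix.nonsing_inv_mul _ (isUnit_det_of_posDef hQ),
      Matrix.one_mulVec]
  rw [hinv, dotProduct, Fintype.sum_option]
  have h1 : ∑ i, w (some i) * x (some i) = z ⬝ᵥ (R⁻¹ *ᵥ z - a • (R⁻¹ *ᵥ ρ)) := rfl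
  rw [h1, dotProduct_sub, dotProduct_smul, smul_eq_mul, ← inv_mulVec_dotProduct hR z ρ,
    dotProduct_comm _ ρ]
  change w none * a + _ = _
  have h2 : (w none - ρ ⬝ᵥ (R⁻¹ *ᵥ z)) ^ 2 / schur Q = a * (w none - ρ ⬝ᵥ (R⁻¹ *ᵥ z)) := by
    rw [ha]; ring
  rw [h2]
  ring

end Border

/-! ### Generalized least squares -/

section LeastSquares

variable {ι κ : Type*} [Fintype ι] [DecidableEq ι] [Fintype κ] [DecidableEq κ]
  {R : Matrix ι ι ℝ} {T : Matrix ι κ ℝ}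

/-- The normal equations. -/
theorem gram_mulVec_glsCoef (hR : R.PosDef)
    (hT : LinearIndependent ℝ fun c : κ => fun x => T x c) (y : ι → ℝ) :
    (Tᵀ * R⁻¹ * T) *ᵥ glsCoef T R y = (Tᵀ * R⁻¹) *ᵥ y := by
  have hA := isUnit_det_of_posDef (posDef_gram hR hT)
  rw [glsCoef, Matrix.mulVec_mulVec, ← Matrix.mul_assoc, ← Matrix.mul_assoc,
    Matrix.mul_nonsing_inv _ hA, Matrix.one_mul]

theorem glsS2_eq (y : ι → ℝ) :
    glsS2 T R y = y ⬝ᵥ (R⁻¹ *ᵥ (y - T *ᵥ glsCoef T R y)) := by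
  simp only [glsS2, glsCoef, Matrix.mulVec_sub, Matrix.mul_sub, Matrix.sub_mulVec,
    Matrix.mulVec_mulVec, Matrix.mul_one, Matrix.mul_assoc]

/-- The residual sum of squares around the least squares fit. -/
theorem dotProduct_residual (hR : R.PosDef)
    (hT : LinearIndependent ℝ fun c : κ => fun x => T x c) (y : ι → ℝ) (b : κ → ℝ) :
    (y - T *ᵥ b) ⬝ᵥ (R⁻¹ *ᵥ (y - T *ᵥ b)) =
      (b - glsCoef T R y) ⬝ᵥ ((Tᵀ * R⁻¹ * T) *ᵥ (b - glsCoef T R y)) + glsS2 T R y := by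
  have hN := gram_mulVec_glsCoef hR hT y
  set g := glsCoef T R y with hg
  -- The normal equations: the residual is orthogonal to the column space in the inner product of
  -- `R⁻¹`, so the cross terms below vanish.
  have key : ∀ d : κ → ℝ, (T *ᵥ d) ⬝ᵥ (R⁻¹ *ᵥ (y - T *ᵥ g)) = 0 := by
    intro d
    rw [← Matrix.vecMul_transpose, ← Matrix.dotProduct_mulVec, Matrix.mulVec_mulVec,
      Matrix.mulVec_sub, ← hN, Matrix.mulVec_mulVec, sub_self, dotProduct_zero]
  have e1 : y - T *ᵥ b = (y - T *ᵥ g) - T *ᵥ (b - g) := by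
    rw [Matrix.mulVec_sub]; abel
  have e2 : (y - T *ᵥ g) ⬝ᵥ (R⁻¹ *ᵥ (y - T *ᵥ g)) = glsS2 T R y := by
    rw [glsS2_eq, sub_dotProduct, key, sub_zero]
  have e3 : (T *ᵥ (b - g)) ⬝ᵥ (R⁻¹ *ᵥ (T *ᵥ (b - g))) =
      (b - g) ⬝ᵥ ((Tᵀ * R⁻¹ * T) *ᵥ (b - g)) := by
    rw [← Matrix.mulVec_mulVec, ← Matrix.mulVec_mulVec, Matrix.dotProduct_mulVec (b - g),
      Matrix.vecMul_transpose]
  rw [e1, Matrix.mulVec_sub R⁻¹, dotProduct_sub, sub_dotProduct (y - T *ᵥ g),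
    sub_dotProduct (y - T *ᵥ g), e2, e3, key,
    ← inv_mulVec_dotProduct hR, dotProduct_comm _ (T *ᵥ (b - g)), key]
  ring

/-- If the least squares residual is not zero, there are more observations than columns. -/
theorem card_lt_card_of_glsS2_pos (hR : R.PosDef)
    (hT : LinearIndependent ℝ fun c : κ => fun x => T x c) {y : ι → ℝ}
    (hS : 0 < glsS2 T R y) : Fintype.card κ < Fintype.card ι := by
  have hle : Fintype.card κ ≤ Fintype.card ι := by
    simpa using hT.fintype_card_le_finrank
  refine lt_of_le_of_ne hle fun heq => ?_
  -- With as many independent columns as rows, the columns span everything and `y` is fitted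
  -- exactly.
  have hspan : Submodule.span ℝ (Set.range fun c : κ => fun x => T x c) = ⊤ :=
    hT.span_eq_top_of_card_eq_finrank' (by simpa using heq)
  have hy : y ∈ LinearMap.range T.mulVecLin := by
    rw [Matrix.range_mulVecLin]
    exact hspan ▸ Submodule.mem_top
  obtain ⟨b, rfl⟩ := hy
  rw [Matrix.mulVecLin_apply] at hS
  -- The left side is zero here, and it equals a nonnegative term plus S², against S² > 0.
  have h1 := dotProduct_residual hR hT (T *ᵥ b) b
  have h2 := (posDef_gram hR hT).posSemidef.dotProduct_mulVec_nonneg (b - glsCoef T R (T *ᵥ b))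
  simp only [star_trivial] at h2
  rw [sub_self, Matrix.mulVec_zero, dotProduct_zero] at h1
  linarith

end LeastSquares

/-! ### Rank-one updates of the Gram matrix -/

section RankOne

variable {κ : Type*} [Fintype κ] [DecidableEq κ]

/-- Completing the square after adding one observation. -/
theorem complete_square_rank_one {A : Matrix κ κ ℝ} (hA : A.PosDef) (g : κ → ℝ) {k : ℝ}
    (hk : 0 < k) (e : ℝ) (d : κ → ℝ) :
    d ⬝ᵥ (A *ᵥ d) + (e - g ⬝ᵥ d) ^ 2 / k =
      (d - (e / (k + g ⬝ᵥ (A⁻¹ *ᵥ g))) • (A⁻¹ *ᵥ g)) ⬝ᵥ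
        ((A + k⁻¹ • vecMulVec g g) *ᵥ (d - (e / (k + g ⬝ᵥ (A⁻¹ *ᵥ g))) • (A⁻¹ *ᵥ g))) +
      e ^ 2 / (k + g ⬝ᵥ (A⁻¹ *ᵥ g)) := by
  have h0 : 0 ≤ g ⬝ᵥ (A⁻¹ *ᵥ g) := by
    simpa using hA.inv.posSemidef.dotProduct_mulVec_nonneg g
  have hAg : A *ᵥ (A⁻¹ *ᵥ g) = g := by
    rw [Matrix.mulVec_mulVec, Matrix.mul_nonsing_inv _ (isUnit_det_of_posDef hA),
      Matrix.one_mulVec]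
  have hgd : (A⁻¹ *ᵥ g) ⬝ᵥ (A *ᵥ d) = g ⬝ᵥ d := by
    rw [Matrix.dotProduct_mulVec, ← Matrix.mulVec_transpose, transpose_of_posDef hA, hAg]
  set p := A⁻¹ *ᵥ g with hp
  set c := k + g ⬝ᵥ p with hc
  have hcpos : 0 < c := by positivity
  have hv : ∀ x : κ → ℝ, vecMulVec g g *ᵥ x = (g ⬝ᵥ x) • g := by
    intro x
    ext i
    simp [Matrix.mulVec, vecMulVec, dotProduct, Finset.mul_sum, mul_comm, mul_left_comm]
  rw [Matrix.add_mulVec, Matrix.smul_mulVec, hv, Matrix.mulVec_sub, Matrix.mulVec_smul, hAg]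
  simp only [dotProduct_add, dotProduct_sub, sub_dotProduct, dotProduct_smul, smul_dotProduct,
    smul_eq_mul, hgd, dotProduct_comm d g, dotProduct_comm p g]
  have hk' : k = c - g ⬝ᵥ p := by rw [hc]; ring
  have : c - g ⬝ᵥ p ≠ 0 := by rw [← hk']; exact hk.ne'
  rw [hk']
  field_simp
  ring

/-- The matrix determinant lemma, multiplied by `k`. It relates the determinant of the updated
precision to the predictive factor c. -/
theorem det_add_rank_one {A : Matrix κ κ ℝ} (hA : A.PosDef) (g : κ → ℝ) {k : ℝ}
    (hk : 0 < k) :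
    (A + k⁻¹ • vecMulVec g g).det * k = A.det * (k + g ⬝ᵥ (A⁻¹ *ᵥ g)) := by
  rw [← Matrix.smul_vecMulVec, vecMulVec_eq Unit,
    Matrix.det_add_replicateCol_mul_replicateRow (isUnit_det_of_posDef hA),
    Matrix.det_unique (n := Unit)]
  simp only [Matrix.add_apply, Matrix.one_apply_eq, Matrix.mul_assoc]
  have : (replicateRow Unit g * (A⁻¹ * replicateCol Unit (k⁻¹ • g))) default default =
      k⁻¹ * (g ⬝ᵥ (A⁻¹ *ᵥ g)) := by
    rw [← Matrix.replicateCol_mulVec, Matrix.mulVec_smul]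
    simp [Matrix.mul_apply, dotProduct, Finset.mul_sum, mul_left_comm]
  rw [this]
  field_simp

end RankOne

/-! ### Normal densities with a scaled covariance matrix -/

section ScaledNormal

variable {n : Type*} [Fintype n] [DecidableEq n] {Q : Matrix n n ℝ}

theorem inv_smul_of_posDef (hQ : Q.PosDef) (v : ℝ) : (v • Q)⁻¹ = v⁻¹ • Q⁻¹ := by
  rcases eq_or_ne v 0 with rfl | hv
  · simp
  · refine Matrix.inv_eq_left_inv ?_
    rw [Matrix.smul_mul, Matrix.mul_smul, smul_smul, inv_mul_cancel₀ hv, one_smul,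
      Matrix.nonsing_inv_mul _ (isUnit_det_of_posDef hQ)]

theorem normalPDF_smul (hQ : Q.PosDef) (v : ℝ) (m y : n → ℝ) :
    normalPDF m (v • Q) y =
      (√((2 * Real.pi) ^ Fintype.card n * (v ^ Fintype.card n * Q.det)))⁻¹ *
        Real.exp (-(v⁻¹ * ((y - m) ⬝ᵥ (Q⁻¹ *ᵥ (y - m)))) / 2) := by
  rw [normalPDF, Matrix.det_smul, inv_smul_of_posDef hQ, Matrix.smul_mulVec, dotProduct_smul,
    smul_eq_mul]

/-- Once `v` is pulled out of determinant and inverse, only scalar functions and a fixed quadratic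
form remain; the joint measurability is needed for Tonelli over coefficients and variances. -/
theorem measurable_normalPDF_smul {α : Type*} [MeasurableSpace α] (hQ : Q.PosDef) {v : α → ℝ}
    {m y : α → n → ℝ} (hv : Measurable v) (hm : Measurable m) (hy : Measurable y) :
    Measurable fun a => normalPDF (m a) (v a • Q) (y a) := by
  simp only [normalPDF_smul hQ]
  have h : Continuous fun z : n → ℝ => z ⬝ᵥ (Q⁻¹ *ᵥ z) :=
    Continuous.dotProduct continuous_id (Continuous.matrix_mulVec continuous_const continuous_id)
  have h2 : Measurable fun a => (y a - m a) ⬝ᵥ (Q⁻¹ *ᵥ (y a - m a)) :=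
    h.measurable.comp (hy.sub hm)
  fun_prop

end ScaledNormal

/-! ### Integrating out coefficients and variance at one level -/

section OneLevel

variable {ι κ : Type*} [Fintype ι] [DecidableEq ι] [Fintype κ] [DecidableEq κ]
  (Q : Matrix (Option ι) (Option ι) ℝ) (T : Matrix ι κ ℝ) (T0 : κ → ℝ) (y : ι → ℝ) (u : ℝ)

/-- Location of the prediction at the additional index of a bordered matrix. -/
def predLoc : ℝ :=
  T0 ⬝ᵥ glsCoef T (Q.submatrix some some) y +
    (fun i => Q (some i) none) ⬝ᵥ ((Q.submatrix some some)⁻¹ *ᵥ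
      (y - T *ᵥ glsCoef T (Q.submatrix some some) y))

/-- The part of the regressors at the additional index that kriging does not explain. -/
def predRes : κ → ℝ :=
  T0 - (Tᵀ * (Q.submatrix some some)⁻¹) *ᵥ fun i => Q (some i) none

/-- Scale factor of the prediction at the additional index of a bordered matrix. -/
def predScale : ℝ :=
  schur Q + predRes Q T T0 ⬝ᵥ
    ((Tᵀ * (Q.submatrix some some)⁻¹ * T)⁻¹ *ᵥ predRes Q T T0)

/-- Precision matrix of the regression coefficients, including the additional observation. -/
def precFull : Matrix κ κ ℝ :=
  Tᵀ * (Q.submatrix some some)⁻¹ * T +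
    (schur Q)⁻¹ • vecMulVec (predRes Q T T0) (predRes Q T T0)

/-- Centre of the regression coefficients, including the additional observation. -/
def centreFull : κ → ℝ :=
  glsCoef T (Q.submatrix some some) y +
    ((u - predLoc Q T T0 y) / predScale Q T T0) •
      ((Tᵀ * (Q.submatrix some some)⁻¹ * T)⁻¹ *ᵥ predRes Q T T0)

variable {Q T}

theorem predScale_pos (hQ : Q.PosDef)
    (hT : LinearIndependent ℝ fun c : κ => fun x => T x c) : 0 < predScale Q T T0 := by
  have h := (posDef_gram (posDef_submatrix_some hQ) hT).inv.posSemidef.dotProduct_mulVec_nonneg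
    (predRes Q T T0)
  rw [star_trivial] at h
  exact add_pos_of_pos_of_nonneg (schur_pos hQ) h

theorem posDef_precFull {ι κ : Type*} [Fintype ι] [DecidableEq ι] [Fintype κ]
    {Q : Matrix (Option ι) (Option ι) ℝ} {T : Matrix ι κ ℝ} (T0 : κ → ℝ) (hQ : Q.PosDef)
    (hT : LinearIndependent ℝ fun c : κ => fun x => T x c) : (precFull Q T T0).PosDef :=
  posDef_add_rank_one (posDef_gram (posDef_submatrix_some hQ) hT) _ (schur_pos hQ)

/-- Block elimination, then the least squares decomposition, then the rank-one square completion: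
the new output acts as one more observation with regressor `predRes` and noise variance `schur Q`.
-/
theorem dotProduct_inv_mulVec_residual (hQ : Q.PosDef)
    (hT : LinearIndependent ℝ fun c : κ => fun x => T x c) (b : κ → ℝ)
    {w : Option ι → ℝ} (hw0 : w none = u - T0 ⬝ᵥ b) (hw : w ∘ some = y - T *ᵥ b) :
    w ⬝ᵥ (Q⁻¹ *ᵥ w) =
      (b - centreFull Q T T0 y u) ⬝ᵥ (precFull Q T T0 *ᵥ (b - centreFull Q T T0 y u)) +
        (u - predLoc Q T T0 y) ^ 2 / predScale Q T T0 +
        glsS2 T (Q.submatrix some some) y := by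
  have hR := posDef_submatrix_some hQ
  rw [dotProduct_inv_mulVec_option hQ, hw, hw0, dotProduct_residual hR hT]
  set R := Q.submatrix some some with hRd
  set β := glsCoef T R y with hβ
  set ρ : ι → ℝ := fun i => Q (some i) none with hρ
  -- The kriging error under `b` is the error under the least squares coefficients, corrected
  -- linearly in `b - β`.
  have h1 : u - T0 ⬝ᵥ b - ρ ⬝ᵥ (R⁻¹ *ᵥ (y - T *ᵥ b)) =
      (u - predLoc Q T T0 y) - predRes Q T T0 ⬝ᵥ (b - β) := by
    have h2 : ((Tᵀ * R⁻¹) *ᵥ ρ) ⬝ᵥ (b - β) = ρ ⬝ᵥ (R⁻¹ *ᵥ (T *ᵥ (b - β))) := by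
      rw [← Matrix.mulVec_mulVec, Matrix.mulVec_transpose, ← Matrix.dotProduct_mulVec,
        inv_mulVec_dotProduct hR]
    have h3 : y - T *ᵥ b = (y - T *ᵥ β) - T *ᵥ (b - β) := by
      rw [Matrix.mulVec_sub]; abel
    rw [predRes, sub_dotProduct, h2, predLoc, h3, Matrix.mulVec_sub R⁻¹ (y - T *ᵥ β),
      dotProduct_sub, dotProduct_sub T0]
    ring
  rw [h1]
  have h4 := complete_square_rank_one (posDef_gram hR hT) (predRes Q T T0) (schur_pos hQ)
    (u - predLoc Q T T0 y) (b - β)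
  have h5 : b - centreFull Q T T0 y u = b - β -
      ((u - predLoc Q T T0 y) / predScale Q T T0) •
        ((Tᵀ * R⁻¹ * T)⁻¹ *ᵥ predRes Q T T0) := by
    rw [centreFull]; abel
  rw [h5]
  unfold precFull predScale
  rw [← h4]
  ring

variable (Q T) in
/-- The factor of the marginal density that does not involve the additional observation. -/
def evidence (ν : ℝ) : ℝ :=
  (2 * Real.pi) ^ (-(ν / 2)) *
    (√((Q.submatrix some some).det * (Tᵀ * (Q.submatrix some some)⁻¹ * T).det))⁻¹ *
    (Real.Gamma (ν / 2) * (glsS2 T (Q.submatrix some some) y / 2) ^ (-(ν / 2)))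

variable {y}

theorem evidence_pos (hQ : Q.PosDef)
    (hT : LinearIndependent ℝ fun c : κ => fun x => T x c) {ν : ℝ} (hν : 0 < ν)
    (hS : 0 < glsS2 T (Q.submatrix some some) y) : 0 < evidence Q T y ν := by
  have h1 := (posDef_submatrix_some hQ).det_pos
  have h2 := (posDef_gram (posDef_submatrix_some hQ) hT).det_pos
  have h3 := Real.Gamma_pos_of_pos (show 0 < ν / 2 by positivity)
  have := Real.pi_pos
  unfold evidence
  positivity

variable (y)

/-- The normal density of the full level, split into the parts for the observations, the
additional observation, and the regression coefficients. -/
theorem normalPDF_split (hQ : Q.PosDef)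
    (hT : LinearIndependent ℝ fun c : κ => fun x => T x c) {k : ℕ}
    (hk : Fintype.card ι = Fintype.card κ + k) (b : κ → ℝ)
    {m w : Option ι → ℝ} (hw0 : (w - m) none = u - T0 ⬝ᵥ b) (hw : (w - m) ∘ some = y - T *ᵥ b)
    {v : ℝ} (hv : 0 < v) :
    normalPDF m (v • Q) w =
      (2 * Real.pi) ^ (-((k : ℝ) / 2)) *
        (√((Q.submatrix some some).det * (Tᵀ * (Q.submatrix some some)⁻¹ * T).det))⁻¹ *
      (v ^ (-((k : ℝ) / 2)) * Real.exp (-(glsS2 T (Q.submatrix some some) y / 2 / v)) *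
        ((√(2 * Real.pi * (v * predScale Q T T0)))⁻¹ *
          Real.exp (-(u - predLoc Q T T0 y) ^ 2 / (2 * (v * predScale Q T T0))))) *
      normalPDF (centreFull Q T T0 y u) (v • (precFull Q T T0)⁻¹) b := by
  have hR := posDef_submatrix_some hQ
  have hA := posDef_gram hR hT
  have hA' := posDef_precFull T0 hQ hT
  have hc := predScale_pos T0 hQ hT
  have hκ := schur_pos hQ
  have hpi := Real.pi_pos
  rw [normalPDF_smul hQ, normalPDF_smul hA'.inv,
    dotProduct_inv_mulVec_residual T0 y u hQ hT b hw0 hw,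
    Matrix.nonsing_inv_nonsing_inv _ (isUnit_det_of_posDef hA'), Matrix.det_nonsing_inv,
    Ring.inverse_eq_inv', det_eq_mul_schur hQ]
  have hdet : (precFull Q T T0).det * schur Q =
      (Tᵀ * (Q.submatrix some some)⁻¹ * T).det * predScale Q T T0 := det_add_rank_one hA _ hκ
  have hdR := hR.det_pos
  have hdA := hA.det_pos
  have hdA' := hA'.det_pos
  generalize (Q.submatrix some some).det = dR at *
  generalize (Tᵀ * (Q.submatrix some some)⁻¹ * T).det = dA at *
  generalize (precFull Q T T0).det = dA' at *
  generalize (b - centreFull Q T T0 y u) ⬝ᵥ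
    (precFull Q T T0 *ᵥ (b - centreFull Q T T0 y u)) = q1
  generalize (u - predLoc Q T T0 y) ^ 2 = e2
  generalize glsS2 T (Q.submatrix some some) y = s2
  generalize predScale Q T T0 = c at *
  generalize schur Q = κs at *
  have hexp : Real.exp (-(v⁻¹ * (q1 + e2 / c + s2)) / 2) =
      Real.exp (-(s2 / 2 / v)) * Real.exp (-e2 / (2 * (v * c))) *
        Real.exp (-(v⁻¹ * q1) / 2) := by
    rw [← Real.exp_add, ← Real.exp_add]
    congr 1
    field_simp
    ring
  have hpow : ∀ x : ℝ, 0 < x → x ^ (-((k : ℝ) / 2)) = (√(x ^ k))⁻¹ := by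
    intro x hx
    rw [Real.rpow_neg hx.le, Real.sqrt_eq_rpow, ← Real.rpow_natCast x k, ← Real.rpow_mul hx.le]
    congr 2
    ring
  -- The exponent count is `card ι + 1 = k + 1 + card κ`: `k` goes to the variance integral, 1 to
  -- the new output, `card κ` to the coefficients. The determinants match by `hdet`.
  have hconst : (√((2 * Real.pi) ^ Fintype.card (Option ι) *
        (v ^ Fintype.card (Option ι) * (dR * κs))))⁻¹ =
      (2 * Real.pi) ^ (-((k : ℝ) / 2)) * (√(dR * dA))⁻¹ * v ^ (-((k : ℝ) / 2)) *
        (√(2 * Real.pi * (v * c)))⁻¹ *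
        (√((2 * Real.pi) ^ Fintype.card κ * (v ^ Fintype.card κ * dA'⁻¹)))⁻¹ := by
    rw [hpow _ (by positivity), hpow v hv, ← mul_inv, ← mul_inv, ← mul_inv, ← mul_inv,
      ← Real.sqrt_mul (by positivity), ← Real.sqrt_mul (by positivity),
      ← Real.sqrt_mul (by positivity), ← Real.sqrt_mul (by positivity)]
    congr 2
    have hκs : κs = dA * c / dA' := by rw [← hdet]; field_simp
    rw [Fintype.card_option, hk, hκs]
    field_simp
    ring
  rw [hexp, hconst]
  ring

/-- The reference prior `1 / v` of a variance. -/
def variancePrior : Measure ℝ :=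
  (volume.restrict (Set.Ioi (0 : ℝ))).withDensity fun v => ENNReal.ofReal (1 / v)

/-- At one level, the marginal density is a Student-t density at the additional observation. -/
theorem lintegral_level (hQ : Q.PosDef)
    (hT : LinearIndependent ℝ fun c : κ => fun x => T x c) {ν : ℝ} (hν : 0 < ν)
    (hνc : ν = (Fintype.card ι : ℝ) - Fintype.card κ)
    (hS : 0 < glsS2 T (Q.submatrix some some) y)
    {m : (κ → ℝ) → Option ι → ℝ} {w : Option ι → ℝ}
    (hw0 : ∀ b, (w - m b) none = u - T0 ⬝ᵥ b)
    (hw : ∀ b, (w - m b) ∘ some = y - T *ᵥ b) :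
    ∫⁻ v, (∫⁻ b, ENNReal.ofReal (normalPDF (m b) (v • Q) w)) ∂variancePrior =
      ENNReal.ofReal (evidence Q T y ν) * ENNReal.ofReal (studentPDF ν (predLoc Q T T0 y)
        (glsS2 T (Q.submatrix some some) y / ν * predScale Q T T0) u) := by
  have hc := predScale_pos T0 hQ hT
  have hpi := Real.pi_pos
  have hdR := (posDef_submatrix_some hQ).det_pos
  have hdA := (posDef_gram (posDef_submatrix_some hQ) hT).det_pos
  obtain ⟨k, hk⟩ : ∃ k, Fintype.card ι = Fintype.card κ + k := by
    refine Nat.exists_eq_add_of_le ?_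
    have : (Fintype.card κ : ℝ) < Fintype.card ι := by linarith
    exact_mod_cast this.le
  have hνk : ν = k := by rw [hνc, hk]; push_cast; ring
  have hin : ∀ v ∈ Set.Ioi (0 : ℝ), ENNReal.ofReal (1 / v) *
        ∫⁻ b, ENNReal.ofReal (normalPDF (m b) (v • Q) w) =
      ENNReal.ofReal ((2 * Real.pi) ^ (-(ν / 2)) *
        (√((Q.submatrix some some).det * (Tᵀ * (Q.submatrix some some)⁻¹ * T).det))⁻¹) *
      ENNReal.ofReal (v ^ (-(ν / 2) - 1) *
          Real.exp (-(glsS2 T (Q.submatrix some some) y / 2 / v)) *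
        ((√(2 * Real.pi * (v * predScale Q T T0)))⁻¹ *
          Real.exp (-(u - predLoc Q T T0 y) ^ 2 / (2 * (v * predScale Q T T0))))) := by
    intro v (hv : 0 < v)
    simp_rw [fun b => normalPDF_split T0 y u hQ hT hk b (hw0 b) (hw b) hv]
    rw [← hνk]
    have hposd : (v • (precFull Q T T0)⁻¹).PosDef := (posDef_precFull T0 hQ hT).inv.smul hv
    -- The coefficients enter only through a normal density, of total mass 1.
    have h1 : ∀ {a : ℝ}, 0 ≤ a → ∫⁻ b, ENNReal.ofReal (a *
        normalPDF (centreFull Q T T0 y u) (v • (precFull Q T T0)⁻¹) b) = ENNReal.ofReal a := by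
      intro a ha
      simp_rw [ENNReal.ofReal_mul ha]
      rw [lintegral_const_mul' _ _ ENNReal.ofReal_ne_top, lintegral_normalPDF _ hposd, mul_one]
    rw [h1 (by positivity), ← ENNReal.ofReal_mul (by positivity),
      ← ENNReal.ofReal_mul (by positivity)]
    congr 1
    -- The prior `1 / v` provides the extra `-1` in the inverse gamma exponent.
    rw [Real.rpow_sub_one hv.ne']
    ring
  have hmeas : Measurable fun v => ENNReal.ofReal (1 / v) := by fun_prop
  rw [variancePrior, lintegral_withDensity_eq_lintegral_mul_non_measurable _ hmeas]
  · simp only [Pi.mul_apply]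
    rw [setLIntegral_congr_fun measurableSet_Ioi hin,
      lintegral_const_mul' _ _ ENNReal.ofReal_ne_top,
      lintegral_inverseGamma_mul_gaussian hν hS hc, ← ENNReal.ofReal_mul (by positivity)]
    have hG := Real.Gamma_pos_of_pos (show 0 < ν / 2 by positivity)
    rw [← ENNReal.ofReal_mul (evidence_pos hQ hT hν hS).le]
    congr 1
    unfold evidence
    ring
  · exact Filter.Eventually.of_forall fun v => ENNReal.ofReal_lt_top

end OneLevel

/-! ### Products of successive conditional densities -/

section Triangular

variable {s : ℕ} {f : Fin s → (Fin s → ℝ) → ℝ≥0∞}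

/-- Integrating out the upper coordinates in a product of successive conditional densities. -/
theorem lmarginal_prod_cond (hf : ∀ t, Measurable (f t))
    (hdep : ∀ t y y', (∀ k ≤ t, y k = y' k) → f t y = f t y')
    (hone : ∀ t y, ∫⁻ u, f t (Function.update y t u) = 1) {n : ℕ} (hn : n ≤ s)
    (y : Fin s → ℝ) :
    lmarginal (fun _ => volume) (Finset.univ.filter fun k : Fin s => n ≤ k.val)
        (fun y => ∏ t, f t y) y =
      ∏ t ∈ Finset.univ.filter (fun k : Fin s => k.val < n), f t y := by
  have hm : Measurable fun y : Fin s → ℝ => ∏ t, f t y :=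
    Finset.measurable_prod _ fun t _ => hf t
  -- Starts at `n = s`, where nothing is integrated, and removes the highest remaining coordinate at
  -- each step.
  induction hn using Nat.decreasingInduction generalizing y with
  | self =>
    have h1 : (Finset.univ.filter fun k : Fin s => s ≤ k.val) = ∅ := by
      ext k; simp
    have h2 : (Finset.univ.filter fun k : Fin s => k.val < s) = Finset.univ := by
      ext k; simp
    rw [h1, h2, lmarginal_empty]
  | of_succ n hn ih =>
    set t : Fin s := ⟨n, hn⟩ with ht
    have h1 : (Finset.univ.filter fun k : Fin s => n ≤ k.val) =
        insert t (Finset.univ.filter fun k : Fin s => n + 1 ≤ k.val) := by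
      ext k
      simp only [Finset.mem_filter, Finset.mem_univ, true_and, Finset.mem_insert, Fin.ext_iff, ht]
      omega
    have h2 : (Finset.univ.filter fun k : Fin s => k.val < n + 1) =
        insert t (Finset.univ.filter fun k : Fin s => k.val < n) := by
      ext k
      simp only [Finset.mem_filter, Finset.mem_univ, true_and, Finset.mem_insert, Fin.ext_iff, ht]
      omega
    rw [h1, lmarginal_insert _ hm (by simp [ht])]
    simp_rw [ih, h2]
    -- Factors below level `t` do not see coordinate `t`, so only the factor of `t` is integrated,
    -- to 1.
    have h3 : ∀ u : ℝ, ∏ k ∈ insert t (Finset.univ.filter fun k : Fin s => k.val < n),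
        f k (Function.update y t u) = f t (Function.update y t u) *
          ∏ k ∈ Finset.univ.filter (fun k : Fin s => k.val < n), f k y := by
      intro u
      rw [Finset.prod_insert (by simp [ht])]
      congr 1
      refine Finset.prod_congr rfl fun k hk => hdep k _ _ fun l hl => ?_
      have hk' : k.val < n := by simpa using hk
      rw [Function.update_of_ne]
      intro h
      rw [h, Fin.le_def] at hl
      simp only [ht] at hl
      omega
    simp_rw [h3]
    have hmt : Measurable fun u : ℝ => f t (Function.update y t u) :=
      (hf t).comp (measurable_update y)
    rw [lintegral_mul_const _ hmt, hone, one_mul]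

theorem lintegral_prod_cond (hf : ∀ t, Measurable (f t))
    (hdep : ∀ t y y', (∀ k ≤ t, y k = y' k) → f t y = f t y')
    (hone : ∀ t y, ∫⁻ u, f t (Function.update y t u) = 1) :
    ∫⁻ y, ∏ t, f t y = 1 := by
  have h := lmarginal_prod_cond hf hdep hone (Nat.zero_le s) 0
  have h1 : (Finset.univ.filter fun k : Fin s => 0 ≤ k.val) = Finset.univ := by ext k; simp
  rw [h1, ← lintegral_eq_lmarginal_univ, ← volume_pi] at h
  rw [h]
  simp

end Triangular

/-! ### The predictive distribution and its conditionals -/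

section Predictive

variable {d s : ℕ} {𝒳 : Set (EuclideanSpace ℝ (Fin d))} (S : Setup d s 𝒳)

theorem Setup.posDef_R (hR : ∀ t, (S.Rfull t).PosDef) (t : Fin s) : (S.R t).PosDef :=
  posDef_submatrix_some (hR t)

variable {S} {Y : S.Data}

theorem Setup.dof_pos (hR : ∀ t, (S.Rfull t).PosDef) (hY : S.Regular Y) (t : Fin s) :
    0 < S.dof t := by
  classical
  have h := card_lt_card_of_glsS2_pos (S.posDef_R hR t) (hY t).1 (hY t).2
  rw [Setup.dof, sub_pos]
  rw [Fintype.card_coe] at h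
  exact_mod_cast h

theorem Setup.c_eq_predScale (t : Fin s) (y0 : Fin s → ℝ) :
    S.c t Y y0 = predScale (S.Rfull t) (S.T t Y) (S.T0 t y0) := rfl

theorem Setup.location_eq_predLoc (t : Fin s) (y0 : Fin s → ℝ) :
    S.location t Y y0 = predLoc (S.Rfull t) (S.T t Y) (S.T0 t y0) (Y t) := rfl

open Classical in
theorem Setup.S2_eq_glsS2 (t : Fin s) :
    S.S2 t Y = glsS2 (S.T t Y) ((S.Rfull t).submatrix some some) (Y t) := rfl

theorem Setup.scale_pos (hR : ∀ t, (S.Rfull t).PosDef) (hY : S.Regular Y) (t : Fin s)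
    (y0 : Fin s → ℝ) : 0 < S.scale t Y y0 := by
  have h := predScale_pos (S.T0 t y0) (hR t) (hY t).1
  rw [← S.c_eq_predScale] at h
  exact mul_pos (div_pos (hY t).2 (S.dof_pos hR hY t)) h

/-- The regressors at the new input use at most the output one level below; the triangular
dependence of location, scale and factor comes from here. -/
theorem Setup.T0_congr (t : Fin s) {y0 y0' : Fin s → ℝ} (h : ∀ k < t, y0 k = y0' k) :
    S.T0 t y0 = S.T0 t y0' := by
  ext c
  rcases c with i | u
  · rfl
  · exact h u.1 (by rw [Fin.lt_def]; have := u.2; omega)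

theorem Setup.measurable_T0 (t : Fin s) : Measurable (S.T0 t) := by
  refine measurable_pi_lambda _ fun c => ?_
  rcases c with i | u
  · exact measurable_const
  · exact measurable_pi_apply _

theorem Setup.measurable_location (t : Fin s) : Measurable fun y0 => S.location t Y y0 := by
  have h : Continuous fun z : S.Reg t → ℝ => predLoc (S.Rfull t) (S.T t Y) z (Y t) :=
    (Continuous.dotProduct continuous_id continuous_const).add continuous_const
  exact h.measurable.comp (S.measurable_T0 t)

theorem Setup.measurable_scale (t : Fin s) : Measurable fun y0 => S.scale t Y y0 := by
  have h : Continuous fun z : S.Reg t → ℝ => predScale (S.Rfull t) (S.T t Y) z := by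
    have h1 : Continuous fun z : S.Reg t → ℝ => predRes (S.Rfull t) (S.T t Y) z :=
      continuous_id.sub continuous_const
    exact continuous_const.add
      (Continuous.dotProduct h1 (Continuous.matrix_mulVec continuous_const h1))
  exact (h.measurable.comp (S.measurable_T0 t)).const_mul _

variable (Y) in
/-- The predictive Student-t density of a level as a function of the outputs at the new input. -/
def Setup.factor (t : Fin s) (y0 : Fin s → ℝ) : ℝ≥0∞ :=
  ENNReal.ofReal (studentPDF (S.dof t) (S.location t Y y0) (S.scale t Y y0) (y0 t))

theorem Setup.measurable_factor (t : Fin s) : Measurable (S.factor Y t) :=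
  (measurable_studentPDF _ (S.measurable_location t) (S.measurable_scale t)
    (measurable_pi_apply t)).ennreal_ofReal

theorem Setup.location_congr (t : Fin s) {y0 y0' : Fin s → ℝ} (h : ∀ k < t, y0 k = y0' k) :
    S.location t Y y0 = S.location t Y y0' := by
  rw [S.location_eq_predLoc, S.location_eq_predLoc, S.T0_congr t h]

theorem Setup.scale_congr (t : Fin s) {y0 y0' : Fin s → ℝ} (h : ∀ k < t, y0 k = y0' k) :
    S.scale t Y y0 = S.scale t Y y0' := by
  rw [Setup.scale, Setup.scale, S.c_eq_predScale, S.c_eq_predScale, S.T0_congr t h]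

theorem Setup.factor_congr (t : Fin s) (y0 y0' : Fin s → ℝ) (h : ∀ k ≤ t, y0 k = y0' k) :
    S.factor Y t y0 = S.factor Y t y0' := by
  have h' : ∀ k < t, y0 k = y0' k := fun k hk => h k hk.le
  rw [Setup.factor, Setup.factor, S.location_congr t h', S.scale_congr t h', h t le_rfl]

theorem Setup.factor_update (t : Fin s) (y0 : Fin s → ℝ) (u : ℝ) :
    S.factor Y t (Function.update y0 t u) =
      ENNReal.ofReal (studentPDF (S.dof t) (S.location t Y y0) (S.scale t Y y0) u) := by
  have h : ∀ k < t, Function.update y0 t u k = y0 k := fun k hk =>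
    Function.update_of_ne hk.ne _ _
  rw [Setup.factor, S.location_congr t h, S.scale_congr t h, Function.update_self]

theorem Setup.lintegral_factor (hR : ∀ t, (S.Rfull t).PosDef) (hY : S.Regular Y) (t : Fin s)
    (y0 : Fin s → ℝ) : ∫⁻ u, S.factor Y t (Function.update y0 t u) = 1 := by
  simp_rw [S.factor_update]
  exact lintegral_studentPDF (S.dof_pos hR hY t) (S.scale_pos hR hY t y0) _

theorem Setup.factor_pos (hR : ∀ t, (S.Rfull t).PosDef) (hY : S.Regular Y) (t : Fin s)
    (y0 : Fin s → ℝ) : 0 < S.factor Y t y0 :=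
  ENNReal.ofReal_pos.2 (studentPDF_pos (S.dof_pos hR hY t) (S.scale_pos hR hY t y0) _)

instance : SigmaFinite variancePrior := by
  unfold variancePrior
  infer_instance

/-- The marginal density is, up to a constant, the product of the Student-t densities. -/
theorem Setup.exists_marginal_eq (hR : ∀ t, (S.Rfull t).PosDef) (hY : S.Regular Y) :
    ∃ K : ℝ≥0∞, K ≠ 0 ∧ K ≠ ∞ ∧ ∀ y0, S.marginal Y y0 = K * ∏ t, S.factor Y t y0 := by
  classical
  refine ⟨∏ t, ENNReal.ofReal (evidence (S.Rfull t) (S.T t Y) (Y t) (S.dof t)),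
    Finset.prod_ne_zero_iff.2 fun t _ => ?_,
    ENNReal.prod_ne_top fun t _ => ENNReal.ofReal_ne_top, fun y0 => ?_⟩
  · have := evidence_pos (hR t) (hY t).1 (S.dof_pos hR hY t) (y := Y t)
      (S.S2_eq_glsS2 t ▸ (hY t).2)
    simpa using this
  have hprior : S.prior = (Measure.pi fun t => (volume : Measure (S.Reg t → ℝ))).prod
      (Measure.pi fun _ : Fin s => variancePrior) := rfl
  obtain ⟨N, hN⟩ : ∃ N : (t : Fin s) → (S.Reg t → ℝ) → ℝ → ℝ≥0∞, N = fun t b v =>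
    ENNReal.ofReal (normalPDF (S.Tfull t Y y0 *ᵥ b) (v • S.Rfull t) (S.yfull t Y y0)) := ⟨_, rfl⟩
  have hNm : ∀ t, Measurable fun z : (S.Reg t → ℝ) × ℝ => N t z.1 z.2 := by
    intro t
    simp only [hN]
    refine (measurable_normalPDF_smul (hR t) measurable_snd ?_ measurable_const).ennreal_ofReal
    exact ((Continuous.matrix_mulVec continuous_const continuous_id).measurable).comp measurable_fst
  have hsamp : ∀ θ, S.sampling θ Y y0 = ∏ t, N t (θ.1 t) (θ.2 t) := by
    intro θ
    rw [Setup.sampling]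
    refine Finset.prod_congr rfl fun t _ => ?_
    simp only [hN]
  rw [Setup.marginal, hprior]
  simp_rw [hsamp]
  -- Coefficients are integrated inside and variances outside, as in `lintegral_level`; both
  -- integrals then split over the levels.
  rw [lintegral_prod_symm']
  · simp only
    have h1 : ∀ v : Fin s → ℝ, ∫⁻ b : (t : Fin s) → S.Reg t → ℝ, ∏ t, N t (b t) (v t)
        ∂(Measure.pi fun t => (volume : Measure (S.Reg t → ℝ))) =
        ∏ t, ∫⁻ b, N t b (v t) := fun v =>
      lintegral_pi_prod (fun t => (volume : Measure (S.Reg t → ℝ)))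
        fun t => (hNm t).comp (measurable_id.prodMk measurable_const)
    simp_rw [h1]
    rw [lintegral_pi_prod (fun _ => variancePrior) (f := fun t v => ∫⁻ b, N t b v)
      fun t => (hNm t).lintegral_prod_left', ← Finset.prod_mul_distrib]
    refine Finset.prod_congr rfl fun t _ => ?_
    simp only [hN]
    rw [lintegral_level (T := S.T t Y) (S.T0 t y0) (Y t) (y0 t) (hR t) (hY t).1
      (S.dof_pos hR hY t) (by simp [Setup.dof]) (S.S2_eq_glsS2 t ▸ (hY t).2)
      (fun b => rfl) (fun b => rfl)]
    congr 1
  · refine Finset.measurable_prod _ fun t _ => ?_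
    have e1 : Measurable fun θ : S.Params => θ.1 t := by fun_prop
    have e2 : Measurable fun θ : S.Params => θ.2 t := by fun_prop
    exact Measurable.comp (f := fun θ : S.Params => (θ.1 t, θ.2 t)) (hNm t) (e1.prodMk e2)

theorem Setup.lintegral_prod_factor (hR : ∀ t, (S.Rfull t).PosDef) (hY : S.Regular Y) :
    ∫⁻ y0, ∏ t, S.factor Y t y0 = 1 :=
  lintegral_prod_cond S.measurable_factor S.factor_congr (S.lintegral_factor hR hY)

theorem Setup.predictiveDensity_eq (hR : ∀ t, (S.Rfull t).PosDef) (hY : S.Regular Y) :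
    S.predictiveDensity Y = fun y0 => ∏ t, S.factor Y t y0 := by
  obtain ⟨K, hK0, hKt, hK⟩ := S.exists_marginal_eq hR hY
  ext y0
  simp only [Setup.predictiveDensity, hK]
  rw [lintegral_const_mul' _ _ hKt, S.lintegral_prod_factor hR hY, mul_one, mul_comm,
    mul_div_assoc, ENNReal.div_self hK0 hKt, mul_one]

/-- Numerator and denominator are partial products of the factors, up to `t` and below `t`. The
lower factors agree and are positive and finite, so exactly the factor of level `t` survives. -/
theorem Setup.condDensity_eq (hR : ∀ t, (S.Rfull t).PosDef) (hY : S.Regular Y) (t : Fin s)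
    (y0 : Fin s → ℝ) (u : ℝ) :
    S.condDensity t Y y0 u =
      ENNReal.ofReal (studentPDF (S.dof t) (S.location t Y y0) (S.scale t Y y0) u) := by
  have h1 : Finset.Ioi t = Finset.univ.filter fun k : Fin s => t.val + 1 ≤ k.val := by
    ext k; rw [Finset.mem_Ioi, Finset.mem_filter, Fin.lt_def]; simp
  have h2 : Finset.Ici t = Finset.univ.filter fun k : Fin s => t.val ≤ k.val := by
    ext k; rw [Finset.mem_Ici, Finset.mem_filter, Fin.le_def]; simp
  have h3 : (Finset.univ.filter fun k : Fin s => k.val < t.val + 1) =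
      insert t (Finset.univ.filter fun k : Fin s => k.val < t.val) := by
    ext k
    simp only [Finset.mem_filter, Finset.mem_univ, true_and, Finset.mem_insert, Fin.ext_iff]
    omega
  have h4 : ∏ k ∈ Finset.univ.filter (fun k : Fin s => k.val < t.val),
        S.factor Y k (Function.update y0 t u) =
      ∏ k ∈ Finset.univ.filter (fun k : Fin s => k.val < t.val), S.factor Y k y0 := by
    refine Finset.prod_congr rfl fun k hk => S.factor_congr k _ _ fun l hl => ?_
    have hk' : k.val < t.val := by simpa using hk
    rw [Function.update_of_ne]
    rintro rfl
    exact absurd (Fin.le_def.1 hl) (by omega)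
  rw [Setup.condDensity, S.predictiveDensity_eq hR hY, h1, h2,
    lmarginal_prod_cond S.measurable_factor S.factor_congr (S.lintegral_factor hR hY) t.2,
    lmarginal_prod_cond S.measurable_factor S.factor_congr (S.lintegral_factor hR hY) t.2.le,
    h3, Finset.prod_insert (by simp), h4, S.factor_update, mul_div_assoc, ENNReal.div_self,
    mul_one]
  · exact Finset.prod_ne_zero_iff.2 fun k _ => (S.factor_pos hR hY k y0).ne'
  · exact ENNReal.prod_ne_top fun k _ => ENNReal.ofReal_ne_top

theorem Setup.isProbabilityMeasure_predictive (hR : ∀ t, (S.Rfull t).PosDef)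
    (hY : S.Regular Y) : IsProbabilityMeasure (S.predictive Y) := by
  refine ⟨?_⟩
  rw [Setup.predictive, S.predictiveDensity_eq hR hY, withDensity_apply _ MeasurableSet.univ,
    Measure.restrict_univ, S.lintegral_prod_factor hR hY]

theorem Setup.predictive_eq_prod_condDensity (hR : ∀ t, (S.Rfull t).PosDef)
    (hY : S.Regular Y) :
    S.predictive Y = volume.withDensity fun y0 => ∏ t, S.condDensity t Y y0 (y0 t) := by
  rw [Setup.predictive, S.predictiveDensity_eq hR hY]
  congr 1
  ext y0
  exact Finset.prod_congr rfl fun t _ => (S.condDensity_eq hR hY t y0 _).symm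

theorem Setup.condPredictive_eq_studentT (hR : ∀ t, (S.Rfull t).PosDef)
    (hY : S.Regular Y) (t : Fin s) (y0 : Fin s → ℝ) :
    S.condPredictive t Y y0 = studentT (S.dof t) (S.location t Y y0) (S.scale t Y y0) := by
  rw [Setup.condPredictive, studentT]
  congr 1
  ext u
  exact S.condDensity_eq hR hY t y0 u

end Predictive

/-! ### The sampling density via the autoregression -/

section Sampling

variable {d s : ℕ} {𝒳 : Set (EuclideanSpace ℝ (Fin d))} (S : Setup d s 𝒳)

/-- Indices of all outputs: the augmented designs and the new input, over all levels. -/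
abbrev Setup.Idx : Type := (t : Fin s) × Option (S.aug t)

/-- The augmented output and the outputs at the new input as one vector. -/
def Setup.stack (a : S.Data × (Fin s → ℝ)) : S.Idx → ℝ :=
  fun j => S.yfull j.1 a.1 a.2 j.2

/-- Inverse of `Setup.stack`. -/
def Setup.unstack (w : S.Idx → ℝ) : S.Data × (Fin s → ℝ) :=
  (fun t x => w ⟨t, some x⟩, fun t => w ⟨t, none⟩)

/-- An input of a level as an input of the level below. -/
def Setup.lower {t : Fin s} (u : Pred t) : Option (S.aug t) → Option (S.aug u.1) :=
  Option.map fun x => ⟨x.1, S.aug_subset u.2 x.2⟩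

open Classical in
/-- The matrix of the autoregression, mapping the outputs to the discrepancies. -/
def Setup.shear (θ : S.Params) : Matrix S.Idx S.Idx ℝ :=
  1 - Matrix.of fun i j =>
    ∑ u : Pred i.1, θ.1 i.1 (Sum.inr u) * if j = ⟨u.1, S.lower u i.2⟩ then 1 else 0

variable {S}

theorem Setup.pt_lower {t : Fin s} (u : Pred t) (a : Option (S.aug t)) :
    S.pt u.1 (S.lower u a) = S.pt t a := by
  cases a <;> rfl

theorem Setup.shear_mulVec (θ : S.Params) (w : S.Idx → ℝ) (i : S.Idx) :
    (S.shear θ *ᵥ w) i = w i - ∑ u : Pred i.1, θ.1 i.1 (Sum.inr u) * w ⟨u.1, S.lower u i.2⟩ := by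
  classical
  rw [Setup.shear, Matrix.sub_mulVec, Matrix.one_mulVec, Pi.sub_apply]
  congr 1
  simp only [Matrix.mulVec, dotProduct, Matrix.of_apply, Finset.sum_mul]
  rw [Finset.sum_comm]
  refine Finset.sum_congr rfl fun u _ => ?_
  rw [Finset.sum_eq_single ⟨u.1, S.lower u i.2⟩]
  · simp
  · intro j _ hj
    simp [hj]
  · simp

open Classical in
theorem Setup.shear_apply_of_le (θ : S.Params) {i j : S.Idx} (h : i.1 ≤ j.1) :
    S.shear θ i j = (1 : Matrix S.Idx S.Idx ℝ) i j := by
  have h0 : ∑ u : Pred i.1, θ.1 i.1 (Sum.inr u) *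
      (if j = (⟨u.1, S.lower u i.2⟩ : S.Idx) then (1 : ℝ) else 0) = 0 := by
    refine Finset.sum_eq_zero fun u _ => ?_
    rw [if_neg, mul_zero]
    rintro rfl
    have := u.2
    rw [Fin.le_def] at h
    simp only at h
    omega
  rw [Setup.shear, Matrix.sub_apply, Matrix.of_apply, h0, sub_zero]

-- Each level is linked only to the one below, so with the order of levels reversed the matrix is
-- block triangular, and its diagonal blocks are identities.
open Classical in
theorem Setup.det_shear (θ : S.Params) : (S.shear θ).det = 1 := by
  have hbt : (S.shear θ).BlockTriangular fun i => OrderDual.toDual i.1 := by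
    intro i j hij
    have hij' : i.1 < j.1 := hij
    rw [S.shear_apply_of_le θ hij'.le, Matrix.one_apply_ne]
    rintro rfl
    exact lt_irrefl _ hij'
  rw [hbt.det_fintype]
  refine Finset.prod_eq_one fun k _ => ?_
  have : (S.shear θ).toSquareBlock (fun i => OrderDual.toDual i.1) k = 1 := by
    ext i j
    have hij : i.1.1 = j.1.1 := OrderDual.toDual.injective (i.2.trans j.2.symm)
    rw [Matrix.toSquareBlock_def, Matrix.of_apply, S.shear_apply_of_le θ hij.le,
      Matrix.one_apply, Matrix.one_apply]
    simp [Subtype.ext_iff]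
  rw [this]
  convert Matrix.det_one (R := ℝ)
  infer_instance

theorem Setup.unstack_stack (a : S.Data × (Fin s → ℝ)) : S.unstack (S.stack a) = a := rfl

theorem Setup.stack_unstack (w : S.Idx → ℝ) : S.stack (S.unstack w) = w := by
  ext ⟨t, a⟩
  cases a <;> rfl

theorem Setup.measurable_stack : Measurable S.stack := by
  refine measurable_pi_lambda _ fun ⟨t, a⟩ => ?_
  cases a with
  | none =>
    have : Measurable fun a : S.Data × (Fin s → ℝ) => a.2 t := by fun_prop
    exact this
  | some x =>
    have : Measurable fun a : S.Data × (Fin s → ℝ) => a.1 t x := by fun_prop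
    exact this

theorem Setup.measurable_unstack : Measurable S.unstack := by
  refine Measurable.prodMk ?_ ?_
  · refine measurable_pi_lambda _ fun t => measurable_pi_lambda _ fun x => measurable_pi_apply _
  · exact measurable_pi_lambda _ fun t => measurable_pi_apply _

/-- Regrouping coordinates only permutes the sides of a box, so box volumes agree. -/
theorem Setup.map_stack : (volume : Measure (S.Data × (Fin s → ℝ))).map S.stack = volume := by
  symm
  rw [volume_pi]
  refine Measure.pi_eq fun B hB => ?_
  rw [Measure.map_apply S.measurable_stack (MeasurableSet.univ_pi hB)]
  have h : S.stack ⁻¹' Set.pi Set.univ B =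
      (Set.pi Set.univ fun t => Set.pi Set.univ fun x => B ⟨t, some x⟩) ×ˢ
        Set.pi Set.univ fun t => B ⟨t, none⟩ := by
    ext a
    simp only [Set.mem_preimage, Set.mem_pi, Set.mem_univ, forall_const, Set.mem_prod]
    constructor
    · exact fun h => ⟨fun t x => h ⟨t, some x⟩, fun t => h ⟨t, none⟩⟩
    · rintro ⟨h1, h2⟩ ⟨t, a⟩
      cases a with
      | none => exact h2 t
      | some x => exact h1 t x
  rw [h, Measure.volume_eq_prod, Measure.prod_prod, volume_pi_pi, volume_pi_pi,
    Fintype.prod_sigma, ← Finset.prod_mul_distrib]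
  refine Finset.prod_congr rfl fun t _ => ?_
  rw [volume_pi_pi, Fintype.prod_option, mul_comm]

theorem map_uncurry_volume {ι : Type*} [Fintype ι] {κ : ι → Type*} [∀ i, Fintype (κ i)] :
    (volume : Measure (∀ i, κ i → ℝ)).map (fun w (j : (i : ι) × κ i) => w j.1 j.2) = volume := by
  symm
  rw [volume_pi]
  have hm : Measurable fun (w : ∀ i, κ i → ℝ) (j : (i : ι) × κ i) => w j.1 j.2 := by fun_prop
  refine Measure.pi_eq fun B hB => ?_
  rw [Measure.map_apply hm (MeasurableSet.univ_pi hB)]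
  have h : (fun (w : ∀ i, κ i → ℝ) (j : (i : ι) × κ i) => w j.1 j.2) ⁻¹' Set.pi Set.univ B =
      Set.pi Set.univ fun i => Set.pi Set.univ fun k => B ⟨i, k⟩ := by
    ext w
    simp only [Set.mem_preimage, Set.mem_pi, Set.mem_univ, forall_const]
    exact ⟨fun h i k => h ⟨i, k⟩, fun h ⟨i, k⟩ => h i k⟩
  rw [h, volume_pi_pi, Fintype.prod_sigma]
  exact Finset.prod_congr rfl fun i _ => volume_pi_pi _

/-- The autoregression maps Lebesgue measure of the outputs to that of the discrepancies. -/
theorem Setup.exists_inverse_shear_stack (θ : S.Params) :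
    ∃ g : (S.Idx → ℝ) → S.Data × (Fin s → ℝ), Measurable g ∧
      (∀ a, g (S.shear θ *ᵥ S.stack a) = a) ∧ (∀ w, S.shear θ *ᵥ S.stack (g w) = w) ∧
      (volume : Measure (S.Idx → ℝ)).map g = volume := by
  classical
  have hdet : (S.shear θ).det = 1 := by convert S.det_shear θ
  have hu : IsUnit (S.shear θ).det := by rw [hdet]; exact isUnit_one
  have hmeas : ∀ B : Matrix S.Idx S.Idx ℝ, Measurable fun w : S.Idx → ℝ => B *ᵥ w := fun B =>
    (Continuous.matrix_mulVec continuous_const continuous_id).measurable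
  have hg : Measurable fun w => S.unstack ((S.shear θ)⁻¹ *ᵥ w) :=
    S.measurable_unstack.comp (hmeas _)
  have hga : ∀ a, S.unstack ((S.shear θ)⁻¹ *ᵥ (S.shear θ *ᵥ S.stack a)) = a := fun a => by
    rw [Matrix.mulVec_mulVec, Matrix.nonsing_inv_mul _ hu, Matrix.one_mulVec, S.unstack_stack]
  refine ⟨fun w => S.unstack ((S.shear θ)⁻¹ *ᵥ w), hg, hga, fun w => ?_, ?_⟩
  · rw [S.stack_unstack, Matrix.mulVec_mulVec, Matrix.mul_nonsing_inv _ hu, Matrix.one_mulVec]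
  · have h1 : (volume : Measure (S.Idx → ℝ)).map (fun w => S.shear θ *ᵥ w) = volume := by
      have h := Real.map_matrix_volume_pi_eq_smul_volume_pi (M := S.shear θ)
        (by rw [hdet]; exact one_ne_zero)
      have h3 : (⇑(toLin' (S.shear θ)) : (S.Idx → ℝ) → S.Idx → ℝ) =
          fun z => S.shear θ *ᵥ z := by
        ext z i; simp [toLin'_apply]
      rw [h3, hdet] at h
      simpa using h
    have h2 : (volume : Measure (S.Data × (Fin s → ℝ))).map
        (fun a => S.shear θ *ᵥ S.stack a) = volume := by
      have h3 := Measure.map_map (μ := volume) (hmeas (S.shear θ)) S.measurable_stack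
      rw [S.map_stack, h1] at h3
      exact h3.symm
    -- The forward map preserves volume by `h2`; composing it with its inverse shows the same for
    -- the inverse.
    have h4 := Measure.map_map (μ := volume) hg ((hmeas (S.shear θ)).comp S.measurable_stack)
    have h5 : (fun w => S.unstack ((S.shear θ)⁻¹ *ᵥ w)) ∘
        ((fun w => S.shear θ *ᵥ w) ∘ S.stack) = id := funext hga
    rw [h5, Measure.map_id] at h4
    rw [← h4]
    exact congrArg _ h2.symm

theorem normalPDF_congr {n : Type*} [Fintype n] [DecidableEq n] {C : Matrix n n ℝ}
    {m m' y y' : n → ℝ} (h : y - m = y' - m') : normalPDF m C y = normalPDF m' C y' := by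
  rw [normalPDF, normalPDF, h]

theorem Setup.shear_mulVec_stack_observe {N : ℕ} {Ω : Type*} {y : Fin N → Fin s → 𝒳 → Ω → ℝ}
    (θ : S.Params) (j : Fin N) (ω : Ω) (i : S.Idx) :
    (S.shear θ *ᵥ S.stack (S.observe (y j) ω)) i =
      S.discrepancy (y j) θ i.1 (S.pt i.1 i.2) ω := by
  have h : ∀ i : S.Idx, S.stack (S.observe (y j) ω) i = y j i.1 (S.pt i.1 i.2) ω := by
    rintro ⟨t, a⟩
    cases a <;> rfl
  rw [S.shear_mulVec, h, Setup.discrepancy]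
  congr 1
  refine Finset.sum_congr rfl fun u _ => ?_
  rw [h, S.pt_lower]

/-! ### Laws of discrepancies and outputs under the model -/

section Model

variable {N : ℕ} {Ω : Type*} [MeasurableSpace Ω]
  {y : Fin N → Fin s → 𝒳 → Ω → ℝ} {P : (Fin N → S.Params) → Measure Ω}

theorem Setup.measurable_discrepancy (hmodel : S.IsModel y P) (θ : S.Params) (j : Fin N)
    (t : Fin s) (x : 𝒳) : Measurable (S.discrepancy (y j) θ t x) := by
  have h := hmodel.measurable j
  unfold Setup.discrepancy
  exact (h t x).sub (Finset.measurable_sum _ fun u _ => (h u.1 x).const_mul _)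

/-- The mean of the discrepancies of a level on its design and the new input. -/
def Setup.discrepancyMean (θ : S.Params) (t : Fin s) (a : Option (S.aug t)) : ℝ :=
  ∑ i, S.h t (S.pt t a) i * θ.1 t (Sum.inl i)

/-- The autoregressive term may be subtracted from the output or counted in the mean; the centred
vector, all that the normal density sees, is the same. -/
theorem Setup.sub_discrepancyMean (θ : S.Params) (t : Fin s) (Y : S.Data) (y0 : Fin s → ℝ) :
    (fun a => (S.shear θ *ᵥ S.stack (Y, y0)) ⟨t, a⟩) - S.discrepancyMean θ t =
      S.yfull t Y y0 - S.Tfull t Y y0 *ᵥ θ.1 t := by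
  ext a
  rw [Pi.sub_apply, Pi.sub_apply, S.shear_mulVec, Matrix.mulVec, dotProduct,
    Fintype.sum_sum_type, Setup.discrepancyMean]
  have h1 : ∑ i, S.Tfull t Y y0 a (Sum.inl i) * θ.1 t (Sum.inl i) =
      ∑ i, S.h t (S.pt t a) i * θ.1 t (Sum.inl i) := by
    cases a <;> rfl
  have h2 : ∑ u, S.Tfull t Y y0 a (Sum.inr u) * θ.1 t (Sum.inr u) =
      ∑ u : Pred t, θ.1 t (Sum.inr u) * S.stack (Y, y0) ⟨u.1, S.lower u a⟩ := by
    refine Finset.sum_congr rfl fun u _ => ?_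
    rw [mul_comm]
    cases a <;> rfl
  rw [h1, h2]
  change S.yfull t Y y0 a - _ - _ = _
  ring

-- Each level contributes a finite-dimensional marginal of a Gaussian process, hence a normal
-- density; independence over levels makes the joint law a product.
open Classical in
theorem Setup.map_discrepancy (hR : ∀ t, (S.Rfull t).PosDef) (hmodel : S.IsModel y P)
    (θ : Fin N → S.Params) (hθ : ∀ i t, 0 < (θ i).2 t) (j : Fin N) :
    (P θ).map (fun ω (i : S.Idx) => S.discrepancy (y j) (θ j) i.1 (S.pt i.1 i.2) ω) =
      volume.withDensity fun w => ∏ t, ENNReal.ofReal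
        (normalPDF (S.discrepancyMean (θ j) t) ((θ j).2 t • S.Rfull t) fun a => w ⟨t, a⟩) := by
  have hP := hmodel.isProbabilityMeasure θ hθ
  have hpos : ∀ t, ((θ j).2 t • S.Rfull t).PosDef := fun t => (hR t).smul (hθ j t)
  have hmd : ∀ t, Measurable fun ω (a : Option (S.aug t)) =>
      S.discrepancy (y j) (θ j) t (S.pt t a) ω := fun t =>
    measurable_pi_lambda _ fun a => S.measurable_discrepancy hmodel (θ j) j t _
  have hlevel : ∀ t, (P θ).map (fun ω (a : Option (S.aug t)) =>
      S.discrepancy (y j) (θ j) t (S.pt t a) ω) =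
      volume.withDensity fun w => ENNReal.ofReal
        (normalPDF (S.discrepancyMean (θ j) t) ((θ j).2 t • S.Rfull t) w) := by
    intro t
    have hgp := hmodel.isGP θ hθ j t
    refine map_eq_withDensity_normalPDF
      (X := fun a => S.discrepancy (y j) (θ j) t (S.pt t a)) ?_ (fun a => hgp.mean _)
      (fun a a' => ?_) (hpos t)
    · have h := ((hgp.isGaussianProcess.comp_right (S.pt t)).hasGaussianLaw Finset.univ)
      exact h.map_fun (ContinuousLinearMap.pi fun a => ContinuousLinearMap.proj
        (R := ℝ) (φ := fun _ : (Finset.univ : Finset (Option (S.aug t))) => ℝ)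
        ⟨a, Finset.mem_univ a⟩)
    · rw [hgp.cov]
      rfl
  have hind : iIndepFun (fun (t : Fin s) ω (a : Option (S.aug t)) =>
      S.discrepancy (y j) (θ j) t (S.pt t a) ω) (P θ) := by
    -- Independence over all pairs is restricted to the fixed coordinate `j`.
    have h1 := (hmodel.indep θ hθ).precomp (g := fun t : Fin s => (j, t))
      (fun t t' h => (Prod.mk.inj h).2)
    exact h1.comp (fun t (z : 𝒳 → ℝ) (a : Option (S.aug t)) => z (S.pt t a))
      fun t => measurable_pi_lambda _ fun a => measurable_pi_apply _
  have hjoint := (iIndepFun_iff_map_fun_eq_pi_map fun t => (hmd t).aemeasurable).1 hind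
  simp_rw [hlevel] at hjoint
  have hFm : ∀ t, Measurable fun w => ENNReal.ofReal
      (normalPDF (S.discrepancyMean (θ j) t) ((θ j).2 t • S.Rfull t) w) := fun t =>
    (measurable_normalPDF _ _).ennreal_ofReal
  have : ∀ t, SigmaFinite ((volume : Measure (Option (S.aug t) → ℝ)).withDensity fun w =>
      ENNReal.ofReal (normalPDF (S.discrepancyMean (θ j) t) ((θ j).2 t • S.Rfull t) w)) :=
    fun t => by
      have := isProbabilityMeasure_normalPDF (S.discrepancyMean (θ j) t) (hpos t)
      infer_instance
  rw [pi_withDensity _ hFm, ← volume_pi] at hjoint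
  have hunc : Measurable fun (w : ∀ t, Option (S.aug t) → ℝ) (i : S.Idx) => w i.1 i.2 := by
    fun_prop
  have hcur : Measurable fun (w : S.Idx → ℝ) (t : Fin s) (a : Option (S.aug t)) => w ⟨t, a⟩ := by
    fun_prop
  have h2 : (fun ω (i : S.Idx) => S.discrepancy (y j) (θ j) i.1 (S.pt i.1 i.2) ω) =
      (fun (w : ∀ t, Option (S.aug t) → ℝ) (i : S.Idx) => w i.1 i.2) ∘
        fun ω t a => S.discrepancy (y j) (θ j) t (S.pt t a) ω := rfl
  rw [h2, ← Measure.map_map hunc (measurable_pi_lambda _ hmd), hjoint,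
    map_withDensity_of_leftInverse hunc hcur (fun w => rfl), map_uncurry_volume]
  exact Finset.measurable_prod _ fun t _ => (hFm t).comp (measurable_pi_apply t)

/-- Given the parameters, the outputs at one coordinate have the sampling density. -/
theorem Setup.map_observe (hR : ∀ t, (S.Rfull t).PosDef) (hmodel : S.IsModel y P)
    (θ : Fin N → S.Params) (hθ : ∀ i t, 0 < (θ i).2 t) (j : Fin N) :
    (P θ).map (S.observe (y j)) =
      volume.withDensity fun a => S.sampling (θ j) a.1 a.2 := by
  classical
  obtain ⟨g, hgm, hg1, hg2, hgv⟩ := S.exists_inverse_shear_stack (θ j)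
  have hdm : Measurable fun ω (i : S.Idx) =>
      S.discrepancy (y j) (θ j) i.1 (S.pt i.1 i.2) ω :=
    measurable_pi_lambda _ fun i => S.measurable_discrepancy hmodel (θ j) j i.1 _
  have hobs : S.observe (y j) =
      g ∘ fun ω (i : S.Idx) => S.discrepancy (y j) (θ j) i.1 (S.pt i.1 i.2) ω := by
    ext1 ω
    rw [Function.comp_apply, ← hg1 (S.observe (y j) ω)]
    congr 1
    ext i
    exact S.shear_mulVec_stack_observe (θ j) j ω i
  have hLm : Measurable fun a => S.shear (θ j) *ᵥ S.stack a :=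
    (Continuous.matrix_mulVec continuous_const continuous_id).measurable.comp S.measurable_stack
  rw [hobs, ← Measure.map_map hgm hdm, S.map_discrepancy hR hmodel θ hθ j,
    map_withDensity_of_leftInverse hgm hLm hg2, hgv]
  · congr 1
    ext a
    rw [Setup.sampling]
    refine Finset.prod_congr rfl fun t _ => ?_
    congr 1
    exact normalPDF_congr (S.sub_discrepancyMean (θ j) t a.1 a.2)
  · refine Finset.measurable_prod _ fun t _ => ?_
    refine ((measurable_normalPDF _ _).comp ?_).ennreal_ofReal
    exact measurable_pi_lambda _ fun a => measurable_pi_apply _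

end Model

end Sampling

end PPCokriging

end

theorem proposition1 {d s N : ℕ} {𝒳 : Set (EuclideanSpace ℝ (Fin d))}
    (S : PPCokriging.Setup d s 𝒳)
    (hx0 : ∀ t, S.x0 ∉ S.aug t)
    (hR : ∀ t, (S.Rfull t).PosDef)
    {Ω : Type*} [MeasurableSpace Ω]
    (y : Fin N → Fin s → 𝒳 → Ω → ℝ) (P : (Fin N → S.Params) → Measure Ω)
    (hmodel : S.IsModel y P) (j : Fin N) :
    (∀ θ : Fin N → S.Params, (∀ i t, 0 < (θ i).2 t) →
      (P θ).map (S.observe (y j)) =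
        volume.withDensity (fun a => S.sampling (θ j) a.1 a.2)) ∧
    ∀ Y : S.Data, S.Regular Y →
      IsProbabilityMeasure (S.predictive Y) ∧
      S.predictive Y = volume.withDensity (fun y0 => ∏ t, S.condDensity t Y y0 (y0 t)) ∧
      ∀ (t : Fin s) (y0 : Fin s → ℝ),
        0 < S.dof t ∧ 0 < S.scale t Y y0 ∧
        S.condPredictive t Y y0 =
          PPCokriging.studentT (S.dof t) (S.location t Y y0) (S.scale t Y y0) := by
  refine ⟨fun θ hθ => PPCokriging.Setup.map_observe hR hmodel θ hθ j, fun Y hY =>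
    ⟨PPCokriging.Setup.isProbabilityMeasure_predictive hR hY,
      PPCokriging.Setup.predictive_eq_prod_condDensity hR hY, fun t y0 =>
        ⟨PPCokriging.Setup.dof_pos hR hY t, PPCokriging.Setup.scale_pos hR hY t y0,
          PPCokriging.Setup.condPredictive_eq_studentT hR hY t y0⟩⟩⟩
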